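/- **Setting.** Let $\mathsf B$ be a stationary Bratteli diagram: finite sets $V$ (vertices) and $E$ (edges), the same on every level, with surjective maps $\mathsf s,\mathsf r:E\to V$. Assume $\mathsf B$ is simple: for some $k\ge 1$ any two vertices are joined by a path of length $k$. Let $\Omega_n$ be the set of paths of length $n$ starting on the first level ($\Omega_0=V$), and $\Omega$ the space of infinite paths with the product topology. Let $S$ be a finite set of labels with an involution $F\mapsto F^{-1}$. *Tile inflation.* The tiles $\mathcal T_{v,n}$ ($v\in V$, $n\ge 0$) are $S$-labelled graphs; the vertices of $\mathcal T_{v,n}$ are the paths in $\Omega_n$ ending in $v$. On $\mathcal T_{v,0}$, a single vertex, there are no arrows and every label is *hanging*. For every $n$ a set of connectors $(\gamma,\gamma',F)$, $\gamma,\gamma'\in\Omega_{n+1}$, $F\in S$, is given such that: $\gamma,\gamma'$ end in the same vertex; $F$ hangs at the truncation of $\gamma$ to $\Omega_n$ and $F^{-1}$ at that of $\gamma'$; $(\gamma',\gamma,F^{-1})$ is again a connector; and $\gamma'$ is determined by $\gamma$ and $F$. The arrows of $\mathcal T_{v,n+1}$ are the arrows $\gamma e\to\gamma' e$ for all arrows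 $\gamma\to\gamma'$ of $\mathcal T_{\mathsf s(e),n}$ and all $e\in E$ with $\mathsf r(e)=v$, with the same label, together with an arrow $\gamma\to\gamma'$ labelled $F$ for every connector $(\gamma,\gamma',F)$. A label $F$ hangs at a vertex of $\mathcal T_{v,n+1}$ if it hangs at its truncation and no connector with label $F$ starts at this vertex. A vertex with a hanging label is a *boundary point*; $B_n\subset\Omega_n$ is the set of boundary points and $C_{n}\subset\Omega_{n}$ ($n\ge 1$) the set of endpoints of connectors of level $n$. Infinite tiles are the direct limits of the tiles along the truncations of infinite paths; an infinite path is a boundary point of an infinite tile if all its truncations are boundary points. *Bounded type.* All tiles are connected, $|B_n\cap\mathcal T_{v,n}|$ is bounded uniformly in $v,n$, only finitely many infinite paths are boundary points of infinite tiles, and there is $C$ such that for all $v,n$ every vertex of every infinite tile is at distance at most $C(\mathrm{Diam}(\mathcal T_{v,n})+1)$, in this infinite tile, from a copy of $\mathcal T_{v,n}$ embedded in it as a labelled graph. *Stationary.* For all sufficiently large $n$, the shift (removal of the first edge) restricts to bijections $B_{n+1}\to B_n$ and $C_{n+1}\to C_n$. *The group.* Every $F\in S$ acts as a homeomorphism of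 $\Omega$ with $F^{-1}$ acting as the inverse, and for every connector $(\gamma,\gamma',F)$ it sends $\gamma\tau$ to $\gamma'\tau$ for all continuations $\tau$. Let $G=\langle S\rangle$ be the group of homeomorphisms of $\Omega$ so generated. Assume that the action is minimal and that $G$ is contracting: there is a finite set $\mathcal N$ of partial transformations of $\Omega$ such that for every word $w=s_1\cdots s_m\in S^*$ there is $k$ with ${}_{(\omega,n)}|w\in\mathcal N$ for all $n\ge k$ and $\omega\in\Omega$. Here the section ${}_{(\omega,n)}|w$ is the partial transformation that sends $\tau$ to $\tau'$, where $\zeta\in\Omega$ is such that $\zeta s_1\cdots s_i$ and $\omega s_1\cdots s_i$ have the same first $n$ edges for all $0\le i\le m$, and $\tau,\tau'$ are obtained from $\zeta$, $\zeta s_1\cdots s_m$ by removing the first $n$ edges. *Traverses.* For $w\in S^*$, a traverse of $\mathcal T_{v,n}$ by $w$ is an occurrence in $w$ of a subword of length at least $2$ together with a starting vertex, such that the trajectory of the subword from this vertex runs along arrows of $\mathcal T_{v,n}$, begins and ends at two different boundary points of $\mathcal T_{v,n}$, and contains no other boundary point. Let $T_n$ be the number of traverses by $w$ of all tiles $\mathcal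 T_{v,n}$, $v\in V$, and $F_w(t)=\sum_{n\ge 0}T_nt^n$. **Proposition.** Suppose that there are $t_0>1$ and a function $\Psi$ such that for all $w\in S^*$ and all $0\le t<t_0$ the series $F_w(t)$ converges and $F_w(t)\le |w|\cdot\Psi(t)$. Put $\beta=\limsup_{n\to\infty}\bigl(\sum_{v}|\mathcal T_{v,n}|\bigr)^{1/n}$, and let $\gamma_G(R)$ be the number of elements of $G$ that are products of at most $R$ elements of $S$. Then for every $\alpha>\frac{\log\beta}{\log\beta+\log t_0}$ we have $\gamma_G(R)\preccurlyeq\exp(R^\alpha)$, that is, there is $C\ge 1$ with $\gamma_G(R)\le\exp((CR)^\alpha)$ for all real $R\ge 1$. -/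

import Mathlib

/-- A stationary Bratteli diagram: the vertex set `V`, the edge set `E` and the source and range
maps are the same on every level. -/
structure BratteliDiagram (V E : Type*) where
  src : E → V
  rng : E → V
  src_surjective : Function.Surjective src
  rng_surjective : Function.Surjective rng

namespace BratteliDiagram

/-- A path of length `n` starting on the first level: `n` composable edges together with the
`n + 1` vertices that they visit (for `n = 0` this is just a vertex). -/
@[ext]
structure FinPath {V E : Type*} (B : BratteliDiagram V E) (n : ℕ) where
  vert : Fin (n + 1) → V
  edge : Fin n → E
  src_edge : ∀ i, B.src (edge i) = vert i.castSucc
  rng_edge : ∀ i, B.rng (edge i) = vert i.succ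

namespace FinPath

/-- The vertex in which a finite path ends. -/
def last {V E : Type*} {B : BratteliDiagram V E} {n : ℕ} (p : B.FinPath n) : V :=
  p.vert (Fin.last n)

/-- Remove the last (deepest) edge. -/
def init {V E : Type*} {B : BratteliDiagram V E} {n : ℕ} (p : B.FinPath (n + 1)) :
    B.FinPath n where
  vert i := p.vert i.castSucc
  edge i := p.edge i.castSucc
  src_edge i := p.src_edge i.castSucc
  rng_edge i := p.rng_edge i.castSucc

/-- The last (deepest) edge. -/
def lastEdge {V E : Type*} {B : BratteliDiagram V E} {n : ℕ} (p : B.FinPath (n + 1)) : E :=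
  p.edge (Fin.last n)

/-- The shift `σ`: remove the first edge. -/
def shift {V E : Type*} {B : BratteliDiagram V E} {n : ℕ} (p : B.FinPath (n + 1)) :
    B.FinPath n where
  vert i := p.vert i.succ
  edge i := p.edge i.succ
  src_edge i := p.src_edge i.succ
  rng_edge i := p.rng_edge i.succ

end FinPath

/-- The diagram is simple: for some `k ≥ 1` any two vertices are joined by a path of length `k`. -/
def IsSimple {V E : Type*} (B : BratteliDiagram V E) : Prop :=
  ∃ k : ℕ, 0 < k ∧ ∀ u v : V, ∃ p : B.FinPath k, p.vert 0 = u ∧ p.last = v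

/-- The space `Ω(B)` of infinite paths. -/
def InfPath {V E : Type*} (B : BratteliDiagram V E) : Type _ :=
  {ω : ℕ → E // ∀ i, B.rng (ω i) = B.src (ω (i + 1))}

/-- The topology of `Ω(B)` as a subspace of the product of copies of the discrete set `E`. -/
instance {V E : Type*} (B : BratteliDiagram V E) : TopologicalSpace B.InfPath :=
  TopologicalSpace.induced (fun ω => ω.1) (@Pi.topologicalSpace ℕ (fun _ => E) (fun _ => ⊥))

namespace InfPath

/-- The `n`-th truncation of an infinite path. -/
def trunc {V E : Type*} {B : BratteliDiagram V E} (n : ℕ) (ω : B.InfPath) : B.FinPath n where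
  vert i := B.src (ω.1 i)
  edge i := ω.1 i
  src_edge _ := rfl
  rng_edge i := by simpa using ω.2 i

/-- The `n`-fold shift `σⁿ`: remove the first `n` edges. -/
def drop {V E : Type*} {B : BratteliDiagram V E} (n : ℕ) (ω : B.InfPath) : B.InfPath :=
  ⟨fun i => ω.1 (n + i), fun i => ω.2 (n + i)⟩

end InfPath

/-- `P n F γ γ'` says that `(γ, γ', F)` is a connector of level `n + 1`: in the construction of the
tiles of level `n + 1` an arrow labelled `F` is drawn from `γ` to `γ'`. -/
abbrev Connectors {V E : Type*} (B : BratteliDiagram V E) (S : Type*) : Type _ :=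
  ∀ n : ℕ, S → B.FinPath (n + 1) → B.FinPath (n + 1) → Prop

end BratteliDiagram

open BratteliDiagram

namespace BratteliDiagram.Connectors

/-- `P.IsOut n F γ`: on the level `n` tile an outgoing boundary ("hanging") edge labelled `F` is
attached to `γ` (equivalently, an incoming boundary edge labelled `F⁻¹`).  The tiles of level `0`
are single vertices at which all labels hang; a hanging edge of `γ` is inherited by every
one-edge continuation of `γ` unless a connector uses it there. -/
def IsOut {V E S : Type*} {B : BratteliDiagram V E} (P : B.Connectors S) :
    ∀ n : ℕ, S → B.FinPath n → Prop
  | 0, _, _ => True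
  | n + 1, F, γ => IsOut P n F γ.init ∧ ¬ ∃ γ', P n F γ γ'

/-- `P.TileEdge n F γ γ'`: in the tile of level `n` there is an arrow from `γ` to `γ'` labelled `F`.
A tile of level `n + 1` consists of copies of tiles of level `n` (all paths with a given last edge)
and of the arrows given by the connectors of level `n + 1`. -/
def TileEdge {V E S : Type*} {B : BratteliDiagram V E} (P : B.Connectors S) :
    ∀ n : ℕ, S → B.FinPath n → B.FinPath n → Prop
  | 0, _, _, _ => False
  | n + 1, F, γ, γ' =>
      P n F γ γ' ∨ (γ.lastEdge = γ'.lastEdge ∧ TileEdge P n F γ.init γ'.init)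

/-- The rules of a tile inflation process with a set of labels `S` carrying an involution. -/
structure IsTileInflation {V E S : Type*} [InvolutiveInv S] {B : BratteliDiagram V E}
    (P : B.Connectors S) : Prop where
  /-- Connectors join points of one tile. -/
  last_eq : ∀ {n F γ γ'}, P n F γ γ' → γ.last = γ'.last
  /-- Connectors join copies of tiles along compatible boundary edges. -/
  admissible : ∀ {n F γ γ'}, P n F γ γ' → P.IsOut n F γ.init ∧ P.IsOut n F⁻¹ γ'.init
  /-- Arrows come in mutually inverse pairs. -/
  symm : ∀ {n F γ γ'}, P n F γ γ' → P n F⁻¹ γ' γ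
  /-- The tiles are well-labelled. -/
  unique : ∀ {n F γ γ' γ''}, P n F γ γ' → P n F γ γ'' → γ' = γ''

/-- Boundary points of the tiles of level `n`. -/
def boundary {V E S : Type*} {B : BratteliDiagram V E} (P : B.Connectors S) (n : ℕ) :
    Set (B.FinPath n) :=
  {γ | ∃ F, P.IsOut n F γ}

/-- Connecting points of level `n + 1`. -/
def connecting {V E S : Type*} {B : BratteliDiagram V E} (P : B.Connectors S) (n : ℕ) :
    Set (B.FinPath (n + 1)) :=
  {γ | ∃ F γ', P n F γ γ' ∨ P n F γ' γ}

/-- Boundary points of infinite tiles. -/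
def infBoundary {V E S : Type*} {B : BratteliDiagram V E} (P : B.Connectors S) : Set B.InfPath :=
  {ω | ∀ n, ω.trunc n ∈ P.boundary n}

/-- Vertices of the tile `T_{v,n}`: the paths of length `n` ending in `v`. -/
abbrev Tile {V E : Type*} (B : BratteliDiagram V E) (n : ℕ) (v : V) : Type _ :=
  {γ : B.FinPath n // γ.last = v}

/-- The tile `T_{v,n}` as a graph, modulo loops, multiple edges and labels. -/
def tileGraph {V E S : Type*} {B : BratteliDiagram V E} (P : B.Connectors S) (n : ℕ) (v : V) :
    SimpleGraph (Tile B n v) :=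
  SimpleGraph.fromRel fun x y => ∃ F, P.TileEdge n F x.1 y.1

/-- Arrows of infinite tiles: the infinite tile of a path is the direct limit of the tiles of its
truncations. -/
def InfEdge {V E S : Type*} {B : BratteliDiagram V E} (P : B.Connectors S) (F : S)
    (x y : B.InfPath) : Prop :=
  ∃ n, P.TileEdge n F (x.trunc n) (y.trunc n) ∧ ∀ i, n ≤ i → x.1 i = y.1 i

/-- The disjoint union of all infinite tiles, modulo loops, multiple edges and labels. -/
def infGraph {V E S : Type*} {B : BratteliDiagram V E} (P : B.Connectors S) :
    SimpleGraph B.InfPath :=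
  SimpleGraph.fromRel fun x y => ∃ F, P.InfEdge F x y

/-- All finite tiles are linearly repetitive in all infinite tiles: from every vertex of an infinite
tile one reaches, within a distance linear in the diameter of `T_{v,n}`, an isomorphic copy of
`T_{v,n}` in this infinite tile. -/
def IsLinearlyRepetitive {V E S : Type*} {B : BratteliDiagram V E} (P : B.Connectors S) : Prop :=
  ∃ C : ℕ, ∀ (n : ℕ) (v : V) (ω : B.InfPath), ∃ f : Tile B n v → B.InfPath,
    Function.Injective f ∧
    (∀ F x y, P.TileEdge n F x.1 y.1 → P.InfEdge F (f x) (f y)) ∧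
    ∃ x, P.infGraph.edist ω (f x) ≤ ((C * ((P.tileGraph n v).diam + 1) : ℕ) : ℕ∞)

/-- A tile inflation process of bounded type (with connected tiles). -/
structure IsBoundedType {V E S : Type*} {B : BratteliDiagram V E} (P : B.Connectors S) : Prop where
  tile_connected : ∀ n v, (P.tileGraph n v).Preconnected
  boundary_bounded : ∃ N : ℕ, ∀ n v, {γ ∈ P.boundary n | γ.last = v}.encard ≤ N
  infBoundary_finite : P.infBoundary.Finite
  linearly_repetitive : P.IsLinearlyRepetitive

/-- The automaton of the tile inflation is stationary: from some level on, the shift restricts to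
bijections between the sets of boundary points, and between the sets of connecting points, of
consecutive levels. -/
def IsStationary {V E S : Type*} {B : BratteliDiagram V E} (P : B.Connectors S) : Prop :=
  ∃ N : ℕ, ∀ n, N ≤ n →
    Set.BijOn FinPath.shift (P.boundary (n + 1)) (P.boundary n) ∧
    Set.BijOn FinPath.shift (P.connecting (n + 1)) (P.connecting n)

/-- The traverses of `T_{v,n}` by the word `w`.  The triple `(k, l, γ)` stands for the occurrence of
a subword of length `l ≥ 2` that begins after the first `k` letters of `w` and whose trajectory from
`γ` runs inside the tile `T_{v,n}`, joins two different boundary points, and meets no boundary point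
in between. -/
def traverses {V E S : Type*} {B : BratteliDiagram V E} (P : B.Connectors S) (w : List S) (n : ℕ)
    (v : V) : Set (ℕ × ℕ × B.FinPath n) :=
  {q | 2 ≤ q.2.1 ∧ q.1 + q.2.1 ≤ w.length ∧ ∃ x : ℕ → B.FinPath n,
    x 0 = q.2.2 ∧ (x 0).last = v ∧
    (∀ i < q.2.1, ∃ s, w[q.1 + i]? = some s ∧ P.TileEdge n s (x i) (x (i + 1))) ∧
    x 0 ∈ P.boundary n ∧ x q.2.1 ∈ P.boundary n ∧ x 0 ≠ x q.2.1 ∧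
    ∀ i, 0 < i → i < q.2.1 → x i ∉ P.boundary n}

/-- The number `T_n` of traverses of the word `w` on all tiles of level `n`. -/
noncomputable def traverseCount {V E S : Type*} [Fintype V] {B : BratteliDiagram V E}
    (P : B.Connectors S) (w : List S) (n : ℕ) : ℕ :=
  ∑ v : V, (P.traverses w n v).ncard

/-- The exponential growth rate `β = limsup (∑ᵥ |T_{v,n}|)^{1/n}` of the sizes of the tiles. -/
noncomputable def tileGrowthRate {V E : Type*} [Fintype V] (B : BratteliDiagram V E) : ℝ :=
  Filter.limsup (fun n : ℕ => ((∑ v : V, Nat.card (Tile B n v) : ℕ) : ℝ) ^ (1 / (n : ℝ)))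
    Filter.atTop

/-- A perfectly labelled extension of the infinite tiles: every label acts as a homeomorphism of
`Ω(B)` that follows the arrows of the tiles (so only its values at boundary points of infinite tiles
are not prescribed by the tile inflation). -/
structure PerfectAction {V E S : Type*} [InvolutiveInv S] {B : BratteliDiagram V E}
    (P : B.Connectors S) where
  act : S → B.InfPath ≃ₜ B.InfPath
  act_inv : ∀ F, act F⁻¹ = (act F).symm
  act_connector : ∀ {n F γ γ'}, P n F γ γ' → ∀ ω : B.InfPath, ω.trunc (n + 1) = γ →
    (act F ω).trunc (n + 1) = γ' ∧ ∀ i, n + 1 ≤ i → (act F ω).1 i = ω.1 i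

namespace PerfectAction

/-- The homeomorphism given by a word (right action: the first letter acts first). -/
def word {V E S : Type*} [InvolutiveInv S] {B : BratteliDiagram V E} {P : B.Connectors S}
    (A : PerfectAction P) (w : List S) : B.InfPath ≃ₜ B.InfPath :=
  w.foldl (fun h s => h.trans (A.act s)) (Homeomorph.refl _)

/-- The group `G = ⟨S⟩` of homeomorphisms of `Ω(B)`. -/
def group {V E S : Type*} [InvolutiveInv S] {B : BratteliDiagram V E} {P : B.Connectors S}
    (A : PerfectAction P) : Subgroup (B.InfPath ≃ₜ B.InfPath) :=
  Subgroup.closure (Set.range A.act)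

/-- The growth function `γ_G(R)`: the number of elements of `G` of word length at most `R`. -/
noncomputable def growth {V E S : Type*} [InvolutiveInv S] {B : BratteliDiagram V E}
    {P : B.Connectors S} (A : PerfectAction P) (R : ℝ) : ℝ :=
  ({g : A.group | ∃ w : List S, (w.length : ℝ) ≤ R ∧ A.word w = g}.ncard : ℝ)

/-- The action on `Ω(B)` is minimal. -/
def IsMinimal {V E S : Type*} [InvolutiveInv S] {B : BratteliDiagram V E} {P : B.Connectors S}
    (A : PerfectAction P) : Prop :=
  ∀ ω : B.InfPath, Dense {ω' : B.InfPath | ∃ g ∈ A.group, g ω = ω'}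

/-- The section of the word `w` along `ω` at level `n`, as (the graph of) a partial transformation
of `Ω(B)`: the composition of the states that the letters of `w` reach after reading the first `n`
edges along the trajectory of `ω`.  The state of a letter `F` at `ω` sends `τ` to `τ'` if
`F` sends `ωₙτ` to `ω'ₙτ'`, where `ω' = ω · F`. -/
def sectionAlong {V E S : Type*} [InvolutiveInv S] {B : BratteliDiagram V E} {P : B.Connectors S}
    (A : PerfectAction P) (w : List S) (ω : B.InfPath) (n : ℕ) : Set (B.InfPath × B.InfPath) :=
  {p | ∃ ζ : B.InfPath,
    (∀ i ≤ w.length, (A.word (w.take i) ζ).trunc n = (A.word (w.take i) ω).trunc n) ∧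
    p = (ζ.drop n, (A.word w ζ).drop n)}

/-- `G` is contracting: there is a finite set (containing the nucleus) such that all sections of
any product of generators on all sufficiently deep levels belong to it. -/
def IsContracting {V E S : Type*} [InvolutiveInv S] {B : BratteliDiagram V E} {P : B.Connectors S}
    (A : PerfectAction P) : Prop :=
  ∃ N : Set (Set (B.InfPath × B.InfPath)), N.Finite ∧
    ∀ w : List S, ∃ k : ℕ, ∀ n, k ≤ n → ∀ ω : B.InfPath, A.sectionAlong w ω n ∈ N

end PerfectAction

end BratteliDiagram.Connectors

/-- Domination `f₁ ≼ f₂` of growth functions. -/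
def GrowthDominated (f₁ f₂ : ℝ → ℝ) : Prop :=
  ∃ C : ℝ, 1 ≤ C ∧ ∀ R : ℝ, 1 ≤ R → f₁ R ≤ f₂ (C * R)

/-! Fix a level `n`. Along its trajectory a word follows arrows of tiles of level `n`, which change
only the first `n` edges, except possibly when a letter joins two boundary points. Cut the
trajectory at ends of traverses. Within a piece, after the first visit to the boundary, every
excursion that comes back to the boundary before the cut comes back to the same boundary point;
since it keeps the tail, it acts there as the identity. What remains is a product of single letters
joining boundary points. By stationarity, boundary points of deep levels lie close to the finitely
many boundary points of infinite tiles (`IsStationary.exists_infBoundary`), and contraction leaves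
only finitely many germs between the latter (`IsContracting.exists_finite_germs`). Hence a piece
acts as a change of the first `n` edges, a word from a finite set `U` independent of `n`, and
another change of the first `n` edges (`exists_piece`).

So an element of length at most `R` is computed by a finite table: its states are the paths of
length `n` and the ends of at most `T` traverses, and each step reads a fixed number `m` of further
edges (`exists_table`). The number of tables is exponential in `(|Ω_n| + T) log (|Ω_n| + T)`, up to
constants (`growth_le`). Here `|Ω_n|` is roughly `β ^ n`, and the generating function gives `T ≤ R
|Ψ t| / t ^ n` for `t` just below `t₀`. At `n ≈ log R / (log β + log t₀)` the two bounds balance,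
both being of order `R ^ δ` with `δ` slightly above the critical exponent; the logarithm is absorbed
by `δ < α`. -/

namespace BratteliDiagram

/-! ### Finite and infinite paths, cylinders, compactness. -/

variable {V E : Type*} {B : BratteliDiagram V E}

instance [Finite V] [Finite E] (n : ℕ) : Finite (B.FinPath n) :=
  Finite.of_injective (fun p : B.FinPath n => (p.vert, p.edge)) fun p q h => by
    simp only [Prod.mk.injEq] at h
    exact FinPath.ext h.1 h.2

theorem FinPath.ext_of_init {n : ℕ} {p q : B.FinPath (n + 1)} (h₁ : p.init = q.init)
    (h₂ : p.lastEdge = q.lastEdge) : p = q := by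
  have hv : ∀ i : Fin (n + 1), p.vert i.castSucc = q.vert i.castSucc :=
    fun i => congrFun (congrArg FinPath.vert h₁) i
  have he : ∀ i : Fin n, p.edge i.castSucc = q.edge i.castSucc :=
    fun i => congrFun (congrArg FinPath.edge h₁) i
  have h₂' : p.edge (Fin.last n) = q.edge (Fin.last n) := h₂
  refine FinPath.ext (funext fun i => ?_) (funext fun i => ?_)
  · refine Fin.lastCases ?_ (fun i => hv i) i
    rw [← Fin.succ_last, ← p.rng_edge, ← q.rng_edge, h₂']
  · exact Fin.lastCases h₂' (fun i => he i) i

namespace InfPath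

theorem trunc_eq_iff {n : ℕ} {ω ζ : B.InfPath} :
    ω.trunc n = ζ.trunc n ↔ (∀ i < n, ω.1 i = ζ.1 i) ∧ B.src (ω.1 n) = B.src (ζ.1 n) := by
  constructor
  · intro h
    refine ⟨fun i hi => congrFun (congrArg FinPath.edge h) ⟨i, hi⟩, ?_⟩
    simpa [trunc] using congrFun (congrArg FinPath.vert h) (Fin.last n)
  · rintro ⟨h₁, h₂⟩
    refine FinPath.ext (funext fun i => ?_) (funext fun i => h₁ i i.2)
    rcases (Nat.lt_succ_iff_lt_or_eq.1 i.2) with hi | hi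
    · simp [trunc, h₁ _ hi]
    · simp [trunc, hi, h₂]

theorem trunc_eq_of_le {m n : ℕ} (hmn : m ≤ n) {ω ζ : B.InfPath} (h : ω.trunc n = ζ.trunc n) :
    ω.trunc m = ζ.trunc m := by
  rw [trunc_eq_iff] at h ⊢
  refine ⟨fun i hi => h.1 i (hi.trans_le hmn), ?_⟩
  rcases hmn.lt_or_eq with hlt | rfl
  · rw [h.1 m hlt]
  · exact h.2

theorem trunc_eq_of_forall_lt {m n : ℕ} (hmn : m < n) {ω ζ : B.InfPath}
    (h : ∀ i < n, ω.1 i = ζ.1 i) : ω.trunc m = ζ.trunc m :=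
  trunc_eq_iff.2 ⟨fun i hi => h i (hi.trans hmn), by rw [h m hmn]⟩

theorem eq_of_trunc_of_tail {n : ℕ} {ω ζ : B.InfPath} (h : ω.trunc n = ζ.trunc n)
    (ht : ∀ i, n ≤ i → ω.1 i = ζ.1 i) : ω = ζ :=
  Subtype.ext (funext fun i => (lt_or_ge i n).elim ((trunc_eq_iff.1 h).1 i) (ht i))

theorem drop_eq_iff {n : ℕ} {ω ζ : B.InfPath} :
    ω.drop n = ζ.drop n ↔ ∀ i, n ≤ i → ω.1 i = ζ.1 i := by
  constructor
  · intro h i hi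
    obtain ⟨j, rfl⟩ := Nat.exists_eq_add_of_le hi
    exact congrFun (congrArg Subtype.val h) j
  · exact fun h => Subtype.ext (funext fun i => h _ (Nat.le_add_right _ _))

theorem eq_of_forall_trunc {ω ζ : B.InfPath} (h : ∀ n, ω.trunc n = ζ.trunc n) : ω = ζ :=
  Subtype.ext (funext fun i => (trunc_eq_iff.1 (h (i + 1))).1 i i.lt_succ_self)

/-- Distinct points of a finite set of infinite paths are separated by their truncations of a
common length. -/
theorem exists_injOn_trunc {X : Set B.InfPath} (hX : X.Finite) :
    ∃ K, ∀ n, K ≤ n → Set.InjOn (trunc n) X := by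
  classical
  have h : ∀ p : B.InfPath × B.InfPath, ∃ k, p.1.trunc k = p.2.trunc k → p.1 = p.2 := by
    intro p
    by_cases hp : p.1 = p.2
    · exact ⟨0, fun _ => hp⟩
    · by_contra! hne
      exact hp (eq_of_forall_trunc fun n => (hne n).1)
  choose k hk using h
  obtain ⟨K, hK⟩ := ((hX.prod hX).image k).bddAbove
  exact ⟨K, fun n hn x hx y hy hxy => hk (x, y) (trunc_eq_of_le
    ((hK ⟨(x, y), ⟨hx, hy⟩, rfl⟩).trans hn) hxy)⟩

theorem trunc_shift {n : ℕ} (ω : B.InfPath) : (ω.trunc (n + 1)).shift = (ω.drop 1).trunc n := by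
  refine FinPath.ext (funext fun i => ?_) (funext fun i => ?_) <;>
    simp [trunc, drop, FinPath.shift, add_comm]

/-- Every vertex is the beginning of an infinite path. -/
theorem exists_src_eq (v : V) : ∃ ω : B.InfPath, B.src (ω.1 0) = v := by
  choose g hg using B.src_surjective
  let f : ℕ → E := fun n => Nat.rec (g v) (fun _ e => g (B.rng e)) n
  exact ⟨⟨f, fun i => (hg _).symm⟩, hg v⟩

/-- Every finite path is a truncation of an infinite path with a prescribed tail. -/
theorem exists_trunc_eq_of_tail {n : ℕ} (γ : B.FinPath n) (τ : B.InfPath)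
    (h : B.src (τ.1 0) = γ.last) :
    ∃ ω : B.InfPath, ω.trunc n = γ ∧ ∀ i, ω.1 (n + i) = τ.1 i := by
  let f : ℕ → E := fun i => if hi : i < n then γ.edge ⟨i, hi⟩ else τ.1 (i - n)
  have hsrc : ∀ i : Fin (n + 1), B.src (f i) = γ.vert i := by
    intro i
    rcases (Nat.lt_succ_iff_lt_or_eq.1 i.2) with hi | hi
    · simp only [f, hi, dif_pos]
      exact γ.src_edge ⟨i, hi⟩
    · obtain rfl : i = Fin.last n := Fin.ext hi
      simpa [f, FinPath.last] using h
  have hf : ∀ i, B.rng (f i) = B.src (f (i + 1)) := by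
    intro i
    rcases lt_or_ge i n with hi | hi
    · rw [hsrc ⟨i + 1, by omega⟩]
      simp only [f, hi, dif_pos]
      exact γ.rng_edge ⟨i, hi⟩
    · have h1 : ¬ i < n := by omega
      have h2 : ¬ i + 1 < n := by omega
      simp only [f, h1, h2, dif_neg, not_false_iff]
      rw [τ.2, show i - n + 1 = i + 1 - n by omega]
  refine ⟨⟨f, hf⟩, FinPath.ext (funext fun i => hsrc i) (funext fun i => ?_), fun i => ?_⟩
  · simp [trunc, f]
  · simp [f]

theorem trunc_surjective (n : ℕ) : Function.Surjective (trunc (B := B) n) := fun γ => by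
  obtain ⟨τ, hτ⟩ := exists_src_eq (B := B) γ.last
  obtain ⟨ω, hω, -⟩ := exists_trunc_eq_of_tail γ τ hτ
  exact ⟨ω, hω⟩

open Classical in
/-- Replace the first `n` edges of an infinite path by `γ`, if possible. -/
noncomputable def replace {n : ℕ} (γ : B.FinPath n) (ω : B.InfPath) : B.InfPath :=
  if h : ∃ ζ : B.InfPath, ζ.trunc n = γ ∧ ζ.drop n = ω.drop n then h.choose else ω

theorem replace_eq {n : ℕ} {γ : B.FinPath n} {ω ζ : B.InfPath} (h₁ : ζ.trunc n = γ)
    (h₂ : ∀ i, n ≤ i → ζ.1 i = ω.1 i) : replace γ ω = ζ := by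
  have h : ∃ ζ : B.InfPath, ζ.trunc n = γ ∧ ζ.drop n = ω.drop n := ⟨ζ, h₁, drop_eq_iff.2 h₂⟩
  rw [replace, dif_pos h]
  exact eq_of_trunc_of_tail (h.choose_spec.1.trans h₁.symm)
    fun i hi => (drop_eq_iff.1 h.choose_spec.2 i hi).trans (h₂ i hi).symm

theorem isOpen_setOf_trunc_eq (n : ℕ) (γ : B.FinPath n) :
    IsOpen {ω : B.InfPath | ω.trunc n = γ} := by
  let _ : TopologicalSpace E := ⊥
  have : DiscreteTopology E := ⟨rfl⟩
  have hc : ∀ i, Continuous fun ω : B.InfPath => ω.1 i := fun i =>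
    (continuous_apply i).comp (continuous_induced_dom (f := fun ω : B.InfPath => ω.1))
  rw [isOpen_iff_mem_nhds]
  intro ω hω
  have : {ζ : B.InfPath | ∀ i ∈ Finset.range (n + 1), ζ.1 i = ω.1 i} ∈ nhds ω := by
    have : {ζ : B.InfPath | ∀ i ∈ Finset.range (n + 1), ζ.1 i = ω.1 i} =
      ⋂ i ∈ Finset.range (n + 1), (fun ζ : B.InfPath => ζ.1 i) ⁻¹' {ω.1 i} := by
      ext; simp
    rw [this, Filter.biInter_finset_mem]
    exact fun i _ => (hc i).continuousAt.preimage_mem_nhds (by simp)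
  filter_upwards [this] with ζ hζ
  exact (trunc_eq_of_forall_lt n.lt_succ_self fun i hi => hζ i (Finset.mem_range.2 hi)).trans hω

theorem isClosed_setOf_trunc_mem (n : ℕ) (A : Set (B.FinPath n)) :
    IsClosed {ω : B.InfPath | ω.trunc n ∈ A} := by
  rw [← isOpen_compl_iff]
  have : {ω : B.InfPath | ω.trunc n ∈ A}ᶜ = ⋃ γ ∈ Aᶜ, {ω : B.InfPath | ω.trunc n = γ} := by
    ext; simp
  rw [this]
  exact isOpen_biUnion fun γ _ => isOpen_setOf_trunc_eq n γ

instance [Finite E] : CompactSpace B.InfPath := by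
  let _ : TopologicalSpace E := ⊥
  have : DiscreteTopology E := ⟨rfl⟩
  have hcl : IsClosed {f : ℕ → E | ∀ i, B.rng (f i) = B.src (f (i + 1))} := by
    let _ : TopologicalSpace V := ⊥
    have : DiscreteTopology V := ⟨rfl⟩
    rw [Set.ofPred_forall]
    exact isClosed_iInter fun i => isClosed_eq
      (continuous_of_discreteTopology.comp (continuous_apply i))
      (continuous_of_discreteTopology.comp (continuous_apply (i + 1)))
  have he : Topology.IsClosedEmbedding (fun ω : B.InfPath => ω.1) :=
    ⟨⟨⟨rfl⟩, Subtype.val_injective⟩, by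
      simpa [InfPath, Set.range] using hcl⟩
  exact he.compactSpace

/-- Every neighbourhood of an infinite path contains a cylinder. -/
theorem exists_trunc_of_mem_nhds {ω : B.InfPath} {s : Set B.InfPath} (hs : s ∈ nhds ω) :
    ∃ K, ∀ ζ : B.InfPath, ζ.trunc K = ω.trunc K → ζ ∈ s := by
  let _ : TopologicalSpace E := ⊥
  have : DiscreteTopology E := ⟨rfl⟩
  have h1 : nhds ω = Filter.comap (fun ω : B.InfPath => ω.1) (nhds ω.1) := nhds_induced _ _
  rw [h1, Filter.mem_comap] at hs
  obtain ⟨t, ht, hts⟩ := hs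
  rw [nhds_pi, Filter.mem_pi'] at ht
  obtain ⟨I, u, hu, hut⟩ := ht
  refine ⟨I.sup id + 1, fun ζ hζ => hts (hut fun i hi => ?_)⟩
  have : ζ.1 i = ω.1 i := (trunc_eq_iff.1 hζ).1 i (Nat.lt_succ_of_le (Finset.le_sup (f := id) hi))
  exact Set.mem_of_eq_of_mem this (mem_of_mem_nhds (hu i))

theorem exists_trunc_of_continuous {f : B.InfPath → B.InfPath} (hf : Continuous f) (ω : B.InfPath)
    (n : ℕ) :
    ∃ K, ∀ ζ : B.InfPath, ζ.trunc K = ω.trunc K → (f ζ).trunc n = (f ω).trunc n :=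
  exists_trunc_of_mem_nhds
    (((isOpen_setOf_trunc_eq n ((f ω).trunc n)).preimage hf).mem_nhds rfl)

end InfPath

end BratteliDiagram

/-! ### Boundary points of finite and of infinite tiles. -/

namespace BratteliDiagram.Connectors

variable {V E S : Type*} {B : BratteliDiagram V E} {P : B.Connectors S}

theorem trunc_mem_boundary_of_le {m n : ℕ} (hmn : m ≤ n) {ω : B.InfPath}
    (h : ω.trunc n ∈ P.boundary n) : ω.trunc m ∈ P.boundary m := by
  induction n, hmn using Nat.le_induction with
  | base => exact h
  | succ n _ ih => exact ih (h.imp fun F hF => hF.1)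

/-- A decreasing sequence of subsets of a finite set obtained by iterating a map stabilizes. -/
theorem image_iterate_stabilizes {α : Type*} {A : ℕ → Set α} {φ : α → α} (hA : (A 0).Finite)
    (hanti : Antitone A) (hφ : ∀ k, A (k + 1) = φ '' A k) {k : ℕ} (hk : (A 0).ncard ≤ k) :
    A k = A (A 0).ncard := by
  have hfin : ∀ k, (A k).Finite := fun k => hA.subset (hanti (Nat.zero_le k))
  have hst : ∀ i, A (i + 1) = A i → ∀ k, i ≤ k → A k = A i := by
    intro i hi k hik
    induction k, hik using Nat.le_induction with
    | base => rfl
    | succ k _ ih => rw [hφ, ih, ← hφ, hi]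
  -- Otherwise the cardinality would drop at each of the first `(A 0).ncard + 1` steps.
  have hex : ∃ i ≤ (A 0).ncard, A (i + 1) = A i := by
    by_contra! hne
    have : ∀ i ≤ (A 0).ncard + 1, (A i).ncard + i ≤ (A 0).ncard := by
      intro i
      induction i with
      | zero => simp
      | succ i ih =>
        intro hi
        have h1 := ih (by omega)
        have h2 : (A (i + 1)).ncard < (A i).ncard :=
          Set.ncard_lt_ncard ((hanti i.le_succ).lt_of_ne (hne i (by omega))) (hfin i)
        omega
    have := this _ le_rfl
    omega
  obtain ⟨i, hi, h⟩ := hex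
  rw [hst i h k (hi.trans hk), hst i h _ hi]

/-- If the shift is bijective on boundary points from level `N` on, then a path whose truncation is
a boundary point of a level exceeding `n` by the number of boundary points extends to boundary
points of all levels. -/
theorem exists_boundary_extension [Finite V] [Finite E] {N : ℕ}
    (hN : ∀ n, N ≤ n → Set.BijOn FinPath.shift (P.boundary (n + 1)) (P.boundary n)) {n : ℕ}
    (hn : N ≤ n) {ω : B.InfPath}
    (hω : ω.trunc (n + (P.boundary n).ncard) ∈ P.boundary (n + (P.boundary n).ncard)) (k : ℕ) :
    ∃ ζ : B.InfPath, ζ.trunc n = ω.trunc n ∧ ζ.trunc (n + k) ∈ P.boundary (n + k) := by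
  -- `A k` collects the boundary points of level `n` that survive for `k` more levels.
  let A : ℕ → Set (B.FinPath n) := fun k =>
    InfPath.trunc n '' {ζ : B.InfPath | ζ.trunc (n + k) ∈ P.boundary (n + k)}
  have hA0 : A 0 = P.boundary n := by
    ext γ
    constructor
    · rintro ⟨ζ, hζ, rfl⟩
      exact hζ
    · intro h
      obtain ⟨ζ, rfl⟩ := InfPath.trunc_surjective n γ
      exact ⟨ζ, h, rfl⟩
  have hanti : Antitone A := fun i j hij => Set.image_mono fun ζ hζ =>
    trunc_mem_boundary_of_le (by omega) hζ
  -- `ψ` inverts the shift on boundary points; its other values are arbitrary.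
  have hpre : ∀ x : B.FinPath n, ∃ y : B.FinPath (n + 1), x ∈ P.boundary n →
      y ∈ P.boundary (n + 1) ∧ y.shift = x := by
    intro x
    by_cases hx : x ∈ P.boundary n
    · obtain ⟨y, hy, hyx⟩ := (hN n hn).surjOn hx
      exact ⟨y, fun _ => ⟨hy, hyx⟩⟩
    · obtain ⟨τ, -⟩ := InfPath.exists_src_eq (B := B) x.last
      exact ⟨τ.trunc _, fun h => (hx h).elim⟩
  choose ψ hψ using hpre
  -- Shifting a path that survives `k + 1` levels gives one that survives `k` levels, and conversely
  -- by surjectivity; injectivity recovers the first `n + 1` edges of the original from the first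
  -- `n` edges of its shift. So one map produces each `A (k + 1)` from `A k`, and the sequence
  -- stabilizes.
  have hφ : ∀ k, A (k + 1) = (fun x => (ψ x).init) '' A k := by
    intro k
    ext γ
    constructor
    · rintro ⟨ζ, hζ, rfl⟩
      have h1 : ζ.trunc (n + 1) ∈ P.boundary (n + 1) :=
        trunc_mem_boundary_of_le (n := n + (k + 1)) (by omega) hζ
      have h2 : (ζ.drop 1).trunc n ∈ P.boundary n := by
        rw [← InfPath.trunc_shift]
        exact (hN n hn).mapsTo h1
      refine ⟨(ζ.drop 1).trunc n, ⟨ζ.drop 1, ?_, rfl⟩, ?_⟩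
      · change (ζ.drop 1).trunc (n + k) ∈ P.boundary (n + k)
        rw [← InfPath.trunc_shift]
        exact (hN (n + k) (by omega)).mapsTo hζ
      · have h3 : ψ ((ζ.drop 1).trunc n) = ζ.trunc (n + 1) :=
          (hN n hn).injOn (hψ _ h2).1 h1 (by rw [(hψ _ h2).2, InfPath.trunc_shift])
        change (ψ ((ζ.drop 1).trunc n)).init = _
        rw [h3]
        rfl
    · rintro ⟨-, ⟨ζ, hζ, rfl⟩, rfl⟩
      obtain ⟨c, hc, hcζ⟩ := (hN (n + k) (by omega)).surjOn hζ
      obtain ⟨η, rfl⟩ := InfPath.trunc_surjective _ c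
      rw [InfPath.trunc_shift] at hcζ
      have h1 : η.trunc (n + 1) ∈ P.boundary (n + 1) :=
        trunc_mem_boundary_of_le (n := n + k + 1) (by omega) hc
      have h2 : ζ.trunc n ∈ P.boundary n := trunc_mem_boundary_of_le (n := n + k) (by omega) hζ
      have h3 : ψ (ζ.trunc n) = η.trunc (n + 1) :=
        (hN n hn).injOn (hψ _ h2).1 h1 (by
          rw [(hψ _ h2).2, InfPath.trunc_shift]
          exact (InfPath.trunc_eq_of_le (Nat.le_add_right n k) hcζ).symm)
      refine ⟨η, hc, ?_⟩
      change _ = (ψ (ζ.trunc n)).init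
      rw [h3]
      rfl
  have hfin : (A 0).Finite := Set.toFinite _
  have hmem : ω.trunc n ∈ A (A 0).ncard := ⟨ω, by rw [hA0]; exact hω, rfl⟩
  have hk : ω.trunc n ∈ A k := by
    rcases le_total (A 0).ncard k with h | h
    · rwa [image_iterate_stabilizes hfin hanti hφ h]
    · exact hanti h hmem
  obtain ⟨ζ, hζ, hζω⟩ := hk
  exact ⟨ζ, hζω, hζ⟩

/-- For stationary tile inflations, boundary points of finite tiles are truncations of boundary
points of infinite tiles, up to a bounded number of the deepest edges. -/
theorem IsStationary.exists_infBoundary [Finite V] [Finite E] (h : P.IsStationary) :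
    ∃ N j, ∀ n, N ≤ n → ∀ ω : B.InfPath, ω.trunc (n + j) ∈ P.boundary (n + j) →
      ∃ ξ ∈ P.infBoundary, ω.trunc n = ξ.trunc n := by
  obtain ⟨N, hN⟩ := h
  have hcard : ∀ n, N ≤ n → (P.boundary n).ncard = (P.boundary N).ncard := by
    intro n hn
    induction n, hn using Nat.le_induction with
    | base => rfl
    | succ n hn ih => rw [← ih, ← (hN n hn).1.image_eq, (hN n hn).1.injOn.ncard_image]
  -- The stabilization time is the number of boundary points, which is the same on all levels from
  -- `N` on.
  refine ⟨N, (P.boundary N).ncard, fun n hn ω hω => ?_⟩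
  rw [← hcard n hn] at hω
  have hext := exists_boundary_extension (fun n hn => (hN n hn).1) hn hω
  -- Nested nonempty closed sets in a compact space: a common point is a boundary point of an
  -- infinite tile.
  let Z : ℕ → Set B.InfPath := fun k =>
    {ζ | ζ.trunc n ∈ ({ω.trunc n} : Set _)} ∩ {ζ | ζ.trunc (n + k) ∈ P.boundary (n + k)}
  have hcl : ∀ k, IsClosed (Z k) := fun k =>
    (InfPath.isClosed_setOf_trunc_mem _ _).inter (InfPath.isClosed_setOf_trunc_mem _ _)
  have hne : (⋂ k, Z k).Nonempty := by
    refine IsCompact.nonempty_iInter_of_sequence_nonempty_isCompact_isClosed Z (fun k => ?_)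
      (fun k => ?_) (hcl 0).isCompact hcl
    · exact Set.inter_subset_inter_right _ fun ζ hζ =>
        trunc_mem_boundary_of_le (n := n + (k + 1)) (by omega) hζ
    · obtain ⟨ζ, h1, h2⟩ := hext k
      exact ⟨ζ, h1, h2⟩
  obtain ⟨ξ, hξ⟩ := hne
  rw [Set.mem_iInter] at hξ
  exact ⟨ξ, fun k => trunc_mem_boundary_of_le (Nat.le_add_left k n) (hξ k).2, (hξ 0).1.symm⟩

/-! ### The action of words and its uniform continuity. -/

section Action

variable [InvolutiveInv S]

theorem IsTileInflation.tileEdge_symm (hP : P.IsTileInflation) :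
    ∀ {n : ℕ} {F : S} {γ γ' : B.FinPath n}, P.TileEdge n F γ γ' → P.TileEdge n F⁻¹ γ' γ
  | 0, _, _, _, h => h
  | _ + 1, _, _, _, h => h.imp hP.symm fun h => ⟨h.1.symm, hP.tileEdge_symm h.2⟩

namespace PerfectAction

variable (A : PerfectAction P)

@[simp]
theorem word_nil (ω : B.InfPath) : A.word [] ω = ω := rfl

theorem word_concat (w : List S) (s : S) (ω : B.InfPath) :
    A.word (w ++ [s]) ω = A.act s (A.word w ω) := by
  simp [word, List.foldl_append]

theorem word_append (w₁ w₂ : List S) (ω : B.InfPath) :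
    A.word (w₁ ++ w₂) ω = A.word w₂ (A.word w₁ ω) := by
  induction w₂ using List.reverseRecOn with
  | nil => simp
  | append_singleton w s ih => rw [← List.append_assoc, word_concat, ih, word_concat]

theorem word_take_succ (w : List S) {k : ℕ} {s : S} (h : w[k]? = some s) (ω : B.InfPath) :
    A.word (w.take (k + 1)) ω = A.act s (A.word (w.take k) ω) := by
  rw [List.take_add_one, h]
  exact A.word_concat _ _ _

/-- The homeomorphisms follow the arrows of the tiles. -/
theorem act_tileEdge : ∀ {n : ℕ} {F : S} {ω : B.InfPath} {γ : B.FinPath n},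
    P.TileEdge n F (ω.trunc n) γ →
      (A.act F ω).trunc n = γ ∧ ∀ i, n ≤ i → (A.act F ω).1 i = ω.1 i
  | 0, _, _, _, h => h.elim
  | n + 1, F, ω, γ, h => by
    rcases h with h | ⟨h₁, h₂⟩
    · exact A.act_connector h ω rfl
    · obtain ⟨h₃, h₄⟩ := act_tileEdge (n := n) (ω := ω) h₂
      refine ⟨FinPath.ext_of_init h₃ ?_, fun i hi => h₄ i (by omega)⟩
      rw [← h₁]
      exact h₄ n le_rfl

/-- A label hangs until a connector uses it; the arrow so created is copied to all deeper levels,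
and the action follows it. -/
theorem isOut_or_tileEdge (F : S) (ω : B.InfPath) : ∀ n : ℕ,
    P.IsOut n F (ω.trunc n) ∨ P.TileEdge n F (ω.trunc n) ((A.act F ω).trunc n)
  | 0 => Or.inl trivial
  | n + 1 => by
    rcases isOut_or_tileEdge F ω n with h | h
    · by_cases hc : ∃ γ', P n F (ω.trunc (n + 1)) γ'
      · obtain ⟨γ', hγ⟩ := hc
        rw [(A.act_connector hγ ω rfl).1]
        exact Or.inr (Or.inl hγ)
      · exact Or.inl ⟨h, hc⟩
    · exact Or.inr (Or.inr ⟨((A.act_tileEdge h).2 n le_rfl).symm, h⟩)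

/-- A letter moves a path along an arrow of a tile of level `n`, or else from a boundary point to a
boundary point. -/
theorem tileEdge_or_boundary (hP : P.IsTileInflation) (n : ℕ) (F : S) (ω : B.InfPath) :
    P.TileEdge n F (ω.trunc n) ((A.act F ω).trunc n) ∨
      ω.trunc n ∈ P.boundary n ∧ (A.act F ω).trunc n ∈ P.boundary n := by
  rcases A.isOut_or_tileEdge F ω n with h | h
  · rcases A.isOut_or_tileEdge F⁻¹ (A.act F ω) n with h' | h'
    · exact Or.inr ⟨⟨_, h⟩, ⟨_, h'⟩⟩
    -- Here `F⁻¹` follows an arrow at the image point, and the reverse of this arrow is the one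
    -- required.
    · left
      have := hP.tileEdge_symm h'
      rwa [A.act_inv, Homeomorph.symm_apply_apply, inv_inv] at this
  · exact Or.inl h

/-- The letters have a uniform modulus of continuity. -/
theorem exists_modulus [Finite V] [Finite E] [Finite S] (hP : P.IsTileInflation)
    (hfin : P.infBoundary.Finite) (hst : P.IsStationary) :
    ∃ N j, ∀ n, N ≤ n → ∀ (s : S) (ω ζ : B.InfPath), ω.trunc (n + j) = ζ.trunc (n + j) →
      (A.act s ω).trunc n = (A.act s ζ).trunc n := by
  obtain ⟨N, j, hj⟩ := hst.exists_infBoundary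
  -- Level `K₀` separates the finitely many boundary points of infinite tiles. Beyond level `M`,
  -- points close to one of them have images that agree to level `K₀`.
  obtain ⟨K₀, hK₀⟩ := InfPath.exists_injOn_trunc hfin
  choose K hK using fun (s : S) (ξ : B.InfPath) =>
    InfPath.exists_trunc_of_continuous (A.act s).continuous ξ K₀
  obtain ⟨M, hM⟩ := (Set.Finite.image (fun p : S × B.InfPath => K p.1 p.2)
    (Set.finite_univ.prod hfin)).bddAbove
  refine ⟨max N (max M K₀), j, fun n hn s ω ζ h => ?_⟩
  have hNn : N ≤ n := le_trans (le_max_left _ _) hn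
  have hMn : M ≤ n := le_trans ((le_max_left _ _).trans (le_max_right _ _)) hn
  have hKn : K₀ ≤ n := le_trans ((le_max_right _ _).trans (le_max_right _ _)) hn
  rcases A.tileEdge_or_boundary hP (n + j) s ω with hω | ⟨hω, hωs⟩
  · rw [h] at hω
    exact InfPath.trunc_eq_of_le (Nat.le_add_right n j) (A.act_tileEdge hω).1.symm
  rcases A.tileEdge_or_boundary hP (n + j) s ζ with hζ | ⟨hζ, hζs⟩
  · rw [← h] at hζ
    exact InfPath.trunc_eq_of_le (Nat.le_add_right n j) (A.act_tileEdge hζ).1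
  obtain ⟨ξ, hξ, hωξ⟩ := hj n hNn ω hω
  obtain ⟨ξ₁, hξ₁, hωs₁⟩ := hj n hNn _ hωs
  obtain ⟨ξ₂, hξ₂, hζs₂⟩ := hj n hNn _ hζs
  have hζξ : ζ.trunc n = ξ.trunc n :=
    (InfPath.trunc_eq_of_le (Nat.le_add_right n j) h).symm.trans hωξ
  have hKM : K s ξ ≤ n := (hM ⟨(s, ξ), ⟨trivial, hξ⟩, rfl⟩ : K s ξ ≤ M).trans hMn
  have h1 := hK s ξ ω (InfPath.trunc_eq_of_le hKM hωξ)
  have h2 := hK s ξ ζ (InfPath.trunc_eq_of_le hKM hζξ)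
  -- Agreement at the fixed level `K₀` forces equality, and so the images agree at level `n`,
  -- however large. This makes the loss `j` independent of `n`.
  have : ξ₁ = ξ₂ := hK₀ K₀ le_rfl hξ₁ hξ₂ <| by
    rw [← InfPath.trunc_eq_of_le hKn hωs₁, ← InfPath.trunc_eq_of_le hKn hζs₂, h1, h2]
  rw [hωs₁, hζs₂, this]

/-- Each letter costs `j` edges of precision. -/
theorem word_trunc_eq {N j : ℕ}
    (h : ∀ n, N ≤ n → ∀ (s : S) (ω ζ : B.InfPath), ω.trunc (n + j) = ζ.trunc (n + j) →
      (A.act s ω).trunc n = (A.act s ζ).trunc n) {n L : ℕ} (hn : N ≤ n) {v : List S}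
    (hv : v.length ≤ L) {ω ζ : B.InfPath} (hωζ : ω.trunc (n + j * L) = ζ.trunc (n + j * L)) :
    (A.word v ω).trunc n = (A.word v ζ).trunc n := by
  induction v using List.reverseRecOn generalizing n L with
  | nil => exact InfPath.trunc_eq_of_le (Nat.le_add_right _ _) hωζ
  | append_singleton v s ih =>
    obtain ⟨L, rfl⟩ : ∃ L', L = L' + 1 := ⟨L - 1, by simp at hv; omega⟩
    rw [word_concat, word_concat]
    refine h n hn s _ _ (ih (n := n + j) (L := L) (by omega) (by simpa using hv) ?_)
    rwa [mul_add, mul_one, add_comm (j * L), ← add_assoc] at hωζ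

/-! ### Germs at boundary points and contraction. -/

/-- The words `w` and `w'` have the same germ at `ξ`. -/
def SameGerm (ξ : B.InfPath) (w w' : List S) : Prop :=
  ∃ K, ∀ ζ : B.InfPath, ζ.trunc K = ξ.trunc K → A.word w ζ = A.word w' ζ

theorem SameGerm.symm {ξ : B.InfPath} {w w' : List S} (h : A.SameGerm ξ w w') :
    A.SameGerm ξ w' w :=
  h.imp fun _ hK ζ hζ => (hK ζ hζ).symm

theorem SameGerm.trans {ξ : B.InfPath} {w w' w'' : List S} (h : A.SameGerm ξ w w')
    (h' : A.SameGerm ξ w' w'') : A.SameGerm ξ w w'' := by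
  obtain ⟨K, hK⟩ := h
  obtain ⟨K', hK'⟩ := h'
  exact ⟨max K K', fun ζ hζ => (hK ζ (InfPath.trunc_eq_of_le (le_max_left _ _) hζ)).trans
    (hK' ζ (InfPath.trunc_eq_of_le (le_max_right _ _) hζ))⟩

theorem exists_trunc_trajectory (w : List S) (ξ : B.InfPath) (n : ℕ) :
    ∃ K, ∀ ζ : B.InfPath, ζ.trunc K = ξ.trunc K →
      ∀ i ≤ w.length, (A.word (w.take i) ζ).trunc n = (A.word (w.take i) ξ).trunc n := by
  choose K hK using fun i => InfPath.exists_trunc_of_continuous (A.word (w.take i)).continuous ξ n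
  exact ⟨(Finset.range (w.length + 1)).sup K, fun ζ hζ i hi => hK i ζ (InfPath.trunc_eq_of_le
    (Finset.le_sup (Finset.mem_range.2 (Nat.lt_succ_of_le hi))) hζ)⟩

/-- A point near `ξ` follows the trajectories of `ξ` under both words to depth `n`. The equal
sections then give equal tails of its two images, while the first `n` edges of these are those of
the common image of `ξ`. -/
theorem sameGerm_of_sectionAlong_eq {ξ : B.InfPath} {w w' : List S} {n : ℕ}
    (h : A.word w ξ = A.word w' ξ) (hs : A.sectionAlong w ξ n = A.sectionAlong w' ξ n) :
    A.SameGerm ξ w w' := by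
  obtain ⟨K, hK⟩ := A.exists_trunc_trajectory w ξ n
  obtain ⟨K', hK'⟩ := A.exists_trunc_trajectory w' ξ n
  refine ⟨max K K', fun ζ hζ => ?_⟩
  have h1 := hK ζ (InfPath.trunc_eq_of_le (le_max_left _ _) hζ)
  have h2 := hK' ζ (InfPath.trunc_eq_of_le (le_max_right _ _) hζ)
  have hmem : (ζ.drop n, (A.word w ζ).drop n) ∈ A.sectionAlong w' ξ n := hs ▸ ⟨ζ, h1, rfl⟩
  obtain ⟨ζ', h3, h4⟩ := hmem
  rw [Prod.mk.injEq] at h4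
  obtain rfl : ζ = ζ' := InfPath.eq_of_trunc_of_tail (n := n)
    ((h1 0 (Nat.zero_le _)).trans (h3 0 (Nat.zero_le _)).symm) (InfPath.drop_eq_iff.1 h4.1)
  refine InfPath.eq_of_trunc_of_tail (n := n) ?_ (InfPath.drop_eq_iff.1 h4.2)
  have h5 := h1 _ le_rfl
  have h6 := h2 _ le_rfl
  rw [List.take_length] at h5 h6
  rw [h5, h6, h]

/-- In a contracting group there are finitely many germs with given source and with target in a
given finite set. -/
theorem IsContracting.exists_finite_germs (hc : A.IsContracting) {X : Set B.InfPath}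
    (hX : X.Finite) (ξ : B.InfPath) :
    ∃ U : Set (List S), U.Finite ∧
      ∀ w, A.word w ξ ∈ X → ∃ u ∈ U, A.SameGerm ξ w u := by
  obtain ⟨𝒩, h𝒩, hk⟩ := hc
  choose k hk using hk
  let s : Setoid {w : List S // A.word w ξ ∈ X} :=
    { r := fun w w' => A.SameGerm ξ w.1 w'.1
      iseqv := ⟨fun w => ⟨0, fun _ _ => rfl⟩, fun h => h.symm, fun h h' => h.trans A h'⟩ }
  have hfin : Finite (Quotient s) := by
    by_contra hinf
    rw [not_finite_iff_infinite] at hinf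
    have : Finite (X ×ˢ 𝒩 : Set _) := hX.prod h𝒩
    -- The contraction depth depends on the word, so finitely many words are fixed first, one more
    -- than there are pairs (target, section); on a level deep enough for all of them two words
    -- share such a pair.
    obtain ⟨F, -, hF⟩ := (Set.infinite_univ (α := Quotient s)).exists_subset_card_eq
      ((X ×ˢ 𝒩).ncard + 1)
    let n := F.sup fun q => k q.out.1
    have hmaps : ∀ q ∈ F, (A.word q.out.1 ξ, A.sectionAlong q.out.1 ξ n) ∈
        (hX.prod h𝒩).toFinset := fun q hq => by
      rw [Set.Finite.mem_toFinset]
      exact ⟨q.out.2, hk _ n (Finset.le_sup (f := fun q : Quotient s => k q.out.1) hq) ξ⟩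
    obtain ⟨q, -, q', -, hne, heq⟩ := Finset.exists_ne_map_eq_of_card_lt_of_maps_to
      (by rw [hF, Set.ncard_eq_toFinset_card _ (hX.prod h𝒩)]; exact Nat.lt_succ_self _) hmaps
    rw [Prod.mk.injEq] at heq
    exact hne (Quotient.out_equiv_out.1 (A.sameGerm_of_sectionAlong_eq heq.1 heq.2))
  refine ⟨Set.range fun q : Quotient s => q.out.1, Set.finite_range _, fun w hw => ?_⟩
  exact ⟨_, ⟨Quotient.mk s ⟨w, hw⟩, rfl⟩,
    (Quotient.mk_out (s := s) (⟨w, hw⟩ : {w : List S // A.word w ξ ∈ X})).symm⟩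

/-- There is a finite set of words realizing all germs between boundary points of infinite tiles,
with all needed coincidences holding on cylinders of a fixed level. -/
theorem exists_germ_words [Finite S] (hfin : P.infBoundary.Finite) (hc : A.IsContracting) :
    ∃ (U : Set (List S)) (K K₀ : ℕ), U.Finite ∧ [] ∈ U ∧ K₀ ≤ K ∧
      (∀ ξ ∈ P.infBoundary, ∀ u ∈ U, ∀ s : S, A.word (u ++ [s]) ξ ∈ P.infBoundary →
        ∃ u' ∈ U, ∀ ζ : B.InfPath, ζ.trunc K = ξ.trunc K →
          A.word (u ++ [s]) ζ = A.word u' ζ) ∧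
      (∀ ξ ∈ P.infBoundary, ∀ u ∈ U, ∀ s : S, ∀ ξ' ∈ P.infBoundary, ∀ ζ : B.InfPath,
        ζ.trunc K = ξ.trunc K → (A.word (u ++ [s]) ζ).trunc K₀ = ξ'.trunc K₀ →
          A.word (u ++ [s]) ξ = ξ') := by
  choose W hW hWg using IsContracting.exists_finite_germs A hc hfin
  let U : Set (List S) := {[]} ∪ ⋃ ξ ∈ P.infBoundary, W ξ
  have hU : U.Finite := (Set.finite_singleton _).union (hfin.biUnion fun ξ _ => hW ξ)
  let T : Set (B.InfPath × List S × S) := P.infBoundary ×ˢ U ×ˢ Set.univ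
  have hT : T.Finite := hfin.prod (hU.prod Set.finite_univ)
  -- `K₀` has to separate also the images, which need not be boundary points: an image close to a
  -- boundary point must be equal to it.
  have hY : (P.infBoundary ∪ (fun t : B.InfPath × List S × S =>
    A.word (t.2.1 ++ [t.2.2]) t.1) '' T).Finite := hfin.union (hT.image _)
  obtain ⟨K₀, hK₀⟩ := InfPath.exists_injOn_trunc hY
  have h1 : ∀ t : B.InfPath × List S × S, ∃ K, t ∈ T →
      A.word (t.2.1 ++ [t.2.2]) t.1 ∈ P.infBoundary → ∃ u' ∈ U,
        ∀ ζ : B.InfPath, ζ.trunc K = t.1.trunc K → A.word (t.2.1 ++ [t.2.2]) ζ = A.word u' ζ := by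
    intro t
    by_cases ht : t ∈ T ∧ A.word (t.2.1 ++ [t.2.2]) t.1 ∈ P.infBoundary
    · obtain ⟨u', hu', K, hK⟩ := hWg t.1 _ ht.2
      exact ⟨K, fun _ _ => ⟨u', Or.inr (Set.mem_biUnion ht.1.1 hu'), hK⟩⟩
    · exact ⟨0, fun h h' => (ht ⟨h, h'⟩).elim⟩
  choose K₁ hK₁ using h1
  choose K₂ hK₂ using fun t : B.InfPath × List S × S =>
    InfPath.exists_trunc_of_continuous (A.word (t.2.1 ++ [t.2.2])).continuous t.1 K₀
  obtain ⟨M₁, hM₁⟩ := (hT.image K₁).bddAbove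
  obtain ⟨M₂, hM₂⟩ := (hT.image K₂).bddAbove
  refine ⟨U, max K₀ (max M₁ M₂), K₀, hU, Or.inl rfl, le_max_left _ _, ?_, ?_⟩
  · intro ξ hξ u hu s h
    have ht : (ξ, u, s) ∈ T := ⟨hξ, hu, trivial⟩
    obtain ⟨u', hu', hζ⟩ := hK₁ (ξ, u, s) ht h
    exact ⟨u', hu', fun ζ h => hζ ζ (InfPath.trunc_eq_of_le ((hM₁ ⟨_, ht, rfl⟩).trans
      ((le_max_left _ _).trans (le_max_right _ _))) h)⟩
  · intro ξ hξ u hu s ξ' hξ' ζ hζ h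
    have ht : (ξ, u, s) ∈ T := ⟨hξ, hu, trivial⟩
    refine hK₀ K₀ le_rfl (Or.inr ⟨_, ht, rfl⟩) (Or.inl hξ') ?_
    rw [← h]
    exact (hK₂ (ξ, u, s) ζ (InfPath.trunc_eq_of_le ((hM₂ ⟨_, ht, rfl⟩).trans
      ((le_max_right _ _).trans (le_max_right _ _))) hζ)).symm

end PerfectAction

end Action

end BratteliDiagram.Connectors

/-! ### Trajectories up to the end of the first traverse. -/

namespace BratteliDiagram.Connectors

variable {V E S : Type*} {B : BratteliDiagram V E} {P : B.Connectors S}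

/-- The sequence `γ` of vertices of tiles of level `n` traverses a tile between the times `k` and
`k + l`. -/
def IsTraverse (P : B.Connectors S) (n : ℕ) (γ : ℕ → B.FinPath n) (k l : ℕ) : Prop :=
  2 ≤ l ∧ γ k ∈ P.boundary n ∧ γ (k + l) ∈ P.boundary n ∧ γ k ≠ γ (k + l) ∧
    ∀ i, k < i → i < k + l → γ i ∉ P.boundary n

namespace PerfectAction

variable [InvolutiveInv S] (A : PerfectAction P)

/-- The finite set of words `U` describes the action near the boundary points of level `n`, and
their action is determined by the first `n + m` edges. -/
structure IsGermSystem (U : Set (List S)) (m n : ℕ) : Prop where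
  nil_mem : [] ∈ U
  trunc_eq : ∀ u ∈ U, ∀ (s : S) (ω ζ : B.InfPath), ω.trunc (n + m) = ζ.trunc (n + m) →
    (A.word (u ++ [s]) ω).trunc n = (A.word (u ++ [s]) ζ).trunc n
  exists_eq : ∀ u ∈ U, ∀ (s : S) (ω : B.InfPath), ω.trunc n ∈ P.boundary n →
    (A.word (u ++ [s]) ω).trunc n ∈ P.boundary n →
    ∃ u' ∈ U, ∀ ζ : B.InfPath, ζ.trunc n = ω.trunc n → A.word (u ++ [s]) ζ = A.word u' ζ

/-- A boundary point of a deep level shares its first `K` edges with a boundary point of an infinite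
tile, so the finitely many coincidences of germs hold on its whole cylinder. -/
theorem exists_isGermSystem [Finite V] [Finite E] [Finite S] (hP : P.IsTileInflation)
    (hfin : P.infBoundary.Finite) (hst : P.IsStationary) (hc : A.IsContracting) :
    ∃ (U : Set (List S)) (m N : ℕ), U.Finite ∧ 0 < m ∧
      ∀ n, N ≤ n → A.IsGermSystem U m n := by
  obtain ⟨U, K, K₀, hU, hnil, hK, hgerm, hsep⟩ := A.exists_germ_words hfin hc
  obtain ⟨N₁, j₁, hS⟩ := hst.exists_infBoundary
  obtain ⟨N₂, j₂, hmod⟩ := A.exists_modulus hP hfin hst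
  obtain ⟨L, hL⟩ := (hU.image List.length).bddAbove
  -- The words `u ++ [s]` have length at most `L + 1` and lose `j₂` edges per letter; the extra `1`
  -- only makes `m` positive.
  refine ⟨U, j₂ * (L + 1) + 1, max N₁ K + j₁ + N₂, hU, Nat.succ_pos _, fun n hn =>
    ⟨hnil, ?_, ?_⟩⟩
  · intro u hu s ω ζ h
    refine A.word_trunc_eq hmod (L := L + 1) (by omega) ?_
      (InfPath.trunc_eq_of_le (by omega) h)
    simpa using (hL ⟨u, hu, rfl⟩ : u.length ≤ L)
  · have hnear : ∀ ω : B.InfPath, ω.trunc n ∈ P.boundary n →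
        ∃ ξ ∈ P.infBoundary, ω.trunc K = ξ.trunc K := by
      intro ω hω
      obtain ⟨ξ, hξ, h⟩ := hS (max N₁ K) (le_max_left _ _) ω
        (trunc_mem_boundary_of_le (by omega) hω)
      exact ⟨ξ, hξ, InfPath.trunc_eq_of_le (le_max_right _ _) h⟩
    intro u hu s ω hω hωs
    obtain ⟨ξ, hξ, hωξ⟩ := hnear ω hω
    obtain ⟨ξ', hξ', hωξ'⟩ := hnear _ hωs
    have h := hsep ξ hξ u hu s ξ' hξ' ω hωξ (InfPath.trunc_eq_of_le hK hωξ')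
    obtain ⟨u', hu', h'⟩ := hgerm ξ hξ u hu s (h ▸ hξ')
    exact ⟨u', hu', fun ζ hζ => h' ζ ((InfPath.trunc_eq_of_le
      ((le_max_right N₁ K).trans (by omega)) hζ).trans hωξ)⟩

/-- The position at time `k`, on level `n`, of the trajectory of `ω` under the word `v`. -/
def pos (v : List S) (n : ℕ) (ω : B.InfPath) (k : ℕ) : B.FinPath n :=
  (A.word (v.take k) ω).trunc n

variable {A} {n m : ℕ} {v : List S} {ω ω' : B.InfPath}

theorem tileEdge_of_pos_notMem (hP : P.IsTileInflation) {k : ℕ} {s : S} (hs : v[k]? = some s)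
    (h : A.pos v n ω k ∉ P.boundary n ∨ A.pos v n ω (k + 1) ∉ P.boundary n) :
    P.TileEdge n s (A.pos v n ω k) (A.pos v n ω (k + 1)) := by
  have h' := A.tileEdge_or_boundary hP n s (A.word (v.take k) ω)
  rw [← A.word_take_succ v hs] at h'
  exact h'.resolve_right fun hb => h.elim (· hb.1) (· hb.2)

theorem tail_eq_of_tileEdge {k : ℕ} {s : S} (hs : v[k]? = some s) {γ : B.FinPath n}
    (h : P.TileEdge n s (A.pos v n ω k) γ) :
    A.pos v n ω (k + 1) = γ ∧
      ∀ i, n ≤ i → (A.word (v.take (k + 1)) ω).1 i = (A.word (v.take k) ω).1 i := by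
  rw [pos, A.word_take_succ v hs]
  exact A.act_tileEdge h

theorem pos_succ_eq (hP : P.IsTileInflation) {k : ℕ} (hk : k < v.length)
    (h : A.pos v n ω k ∉ P.boundary n ∨ A.pos v n ω (k + 1) ∉ P.boundary n)
    (hω : A.pos v n ω' k = A.pos v n ω k) : A.pos v n ω' (k + 1) = A.pos v n ω (k + 1) := by
  have hs : v[k]? = some v[k] := List.getElem?_eq_getElem hk
  exact (tail_eq_of_tileEdge hs (hω ▸ tileEdge_of_pos_notMem hP hs h)).1

/-- Only a letter joining two boundary points can change edges beyond the first `n`. -/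
theorem tail_eq (hP : P.IsTileInflation) {a b : ℕ} (hab : a ≤ b) (hb : b ≤ v.length)
    (h : ∀ r, a ≤ r → r < b →
      A.pos v n ω r ∉ P.boundary n ∨ A.pos v n ω (r + 1) ∉ P.boundary n) :
    ∀ i, n ≤ i → (A.word (v.take b) ω).1 i = (A.word (v.take a) ω).1 i := by
  induction b, hab using Nat.le_induction with
  | base => exact fun _ _ => rfl
  | succ b hab ih =>
    intro i hi
    have hs : v[b]? = some v[b] := List.getElem?_eq_getElem hb
    rw [(tail_eq_of_tileEdge hs (tileEdge_of_pos_notMem hP hs (h b hab b.lt_succ_self))).2 i hi]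
    exact ih (by omega) (fun r h1 h2 => h r h1 (by omega)) i hi

/-- Description of the trajectory of `ω` up to the time `p`, with the first visit to the boundary
at the time `q₀` and a later visit at the time `q`, reached from the first one by `u`. -/
structure VisitsBoundary (A : PerfectAction P) (U : Set (List S)) (m n : ℕ) (v : List S)
    (ω : B.InfPath) (p q₀ q : ℕ) (u : List S) : Prop where
  le : q₀ ≤ q
  le' : q ≤ p
  mem : u ∈ U
  first_mem : A.pos v n ω q₀ ∈ P.boundary n
  before : ∀ r < q₀, A.pos v n ω r ∉ P.boundary n
  last_mem : A.pos v n ω q ∈ P.boundary n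
  after : ∀ r, q < r → r < p → A.pos v n ω r ∉ P.boundary n
  eq_word : ∀ ζ : B.InfPath, ζ.trunc (n + m) = ω.trunc (n + m) →
    A.word (v.take q) ζ = A.word u (A.word (v.take q₀) ζ)

/-- All paths close to `ω` have the same positions up to the time `p`. -/
def AgreeUpTo (A : PerfectAction P) (m n : ℕ) (v : List S) (ω : B.InfPath) (p : ℕ) : Prop :=
  ∀ ω' : B.InfPath, ω'.trunc (n + m) = ω.trunc (n + m) → ∀ r ≤ p, A.pos v n ω' r = A.pos v n ω r

variable {U : Set (List S)} {p : ℕ}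

theorem AgreeUpTo.succ (h : AgreeUpTo A m n v ω p)
    (h' : ∀ ω' : B.InfPath, ω'.trunc (n + m) = ω.trunc (n + m) →
      A.pos v n ω' (p + 1) = A.pos v n ω (p + 1)) : AgreeUpTo A m n v ω (p + 1) := by
  intro ω' hω' r hr
  rcases Nat.le_succ_iff.1 hr with hr | rfl
  · exact h ω' hω' r hr
  · exact h' ω' hω'

/-- A step with an end off the boundary follows an arrow and needs no update. A step between two
boundary points appends a letter to `u`, and the germ system replaces the result by another word of
`U`. The final clause says that such a step is always absorbed, so the last recorded visit is never
exactly one letter before an arrival at the boundary. -/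
theorem VisitsBoundary.succ (hP : P.IsTileInflation) (hU : A.IsGermSystem U m n) {q₀ q : ℕ}
    {u : List S} (hp : p < v.length) (h : VisitsBoundary A U m n v ω p q₀ q u)
    (hag : AgreeUpTo A m n v ω p) (hq : q = p ∨ A.pos v n ω p ∉ P.boundary n) :
    AgreeUpTo A m n v ω (p + 1) ∧ ∃ q' u', VisitsBoundary A U m n v ω (p + 1) q₀ q' u' ∧
      (A.pos v n ω (p + 1) ∈ P.boundary n → q' + 1 ≠ p + 1) := by
  have hafter : A.pos v n ω p ∉ P.boundary n ∨ q = p → ∀ r, q < r → r < p + 1 →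
      A.pos v n ω r ∉ P.boundary n := by
    intro hpq r h1 h2
    rcases Nat.lt_succ_iff_lt_or_eq.1 h2 with h2 | rfl
    · exact h.after r h1 h2
    · exact hpq.resolve_right (by omega)
  by_cases hb : A.pos v n ω p ∉ P.boundary n ∨ A.pos v n ω (p + 1) ∉ P.boundary n
  · refine ⟨hag.succ fun ω' hω' => pos_succ_eq hP hp hb (hag ω' hω' p le_rfl), q, u,
      { h with le' := h.le'.trans p.le_succ, after := hafter hq.symm }, fun h1 h2 => ?_⟩
    obtain rfl : q = p := by omega
    exact hb.elim (· h.last_mem) (· h1)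
  push Not at hb
  obtain rfl : q = p := hq.resolve_right (by simpa using hb.1)
  have hs : v[q]? = some v[q] := List.getElem?_eq_getElem hp
  have hword : ∀ ω' : B.InfPath, ω'.trunc (n + m) = ω.trunc (n + m) →
      A.word (v.take (q + 1)) ω' = A.word (u ++ [v[q]]) (A.word (v.take q₀) ω') := by
    intro ω' hω'
    rw [A.word_take_succ v hs, h.eq_word ω' hω', A.word_concat]
  have hb' := hb.2
  rw [pos, hword ω rfl] at hb'
  obtain ⟨u', hu', hz⟩ := hU.exists_eq u h.mem v[q] _ h.first_mem hb'
  have htail : ∀ ω' : B.InfPath, ω'.trunc (n + m) = ω.trunc (n + m) →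
      ∀ i, n ≤ i → (A.word (v.take q₀) ω').1 i = ω'.1 i := by
    intro ω' hω'
    refine tail_eq hP (Nat.zero_le q₀) (h.le.trans hp.le) fun r _ hr => Or.inl ?_
    rw [hag ω' hω' r (by have := h.le; omega)]
    exact h.before r hr
  refine ⟨hag.succ fun ω' hω' => ?_, q + 1, u', ⟨h.le.trans q.le_succ, le_rfl, hu', h.first_mem,
    h.before, hb.2, fun r h1 h2 => by omega, fun ω' hω' => ?_⟩, fun _ => by omega⟩
  · rw [pos, pos, hword ω' hω', hword ω rfl]
    -- At the time `q₀` the first `n` edges are known from `hag`, and the tail is still that of the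
    -- initial path; this determines the first `n + m` edges there.
    refine hU.trunc_eq u h.mem _ _ _ ?_
    have h1 := InfPath.trunc_eq_iff.1 hω'
    have h2 := InfPath.trunc_eq_iff.1 (hag ω' hω' q₀ h.le)
    refine InfPath.trunc_eq_iff.2 ⟨fun i hi => ?_, ?_⟩
    · rcases lt_or_ge i n with hin | hin
      · exact h2.1 i hin
      · rw [htail ω' hω' i hin, htail ω rfl i hin, h1.1 i hi]
    · rw [htail ω' hω' _ (by omega), htail ω rfl _ (by omega), h1.2]
  · rw [hword ω' hω']
    exact hz _ (hag ω' hω' q₀ h.le)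

/-- An excursion of at least two letters back to the boundary that is not a traverse ends where it
began. It also keeps the tail, so it is the identity on the nearby paths, and the last visit can be
moved to `p` with the same `u`. -/
theorem VisitsBoundary.normalize (hP : P.IsTileInflation) {q₀ q : ℕ} {u : List S}
    (hp : p ≤ v.length) (h : VisitsBoundary A U m n v ω p q₀ q u) (hag : AgreeUpTo A m n v ω p)
    (hq : A.pos v n ω p ∈ P.boundary n → q + 1 ≠ p)
    (hno : ∀ k l, IsTraverse P n (A.pos v n ω) k l → k + l ≠ p) :
    ∃ q', VisitsBoundary A U m n v ω p q₀ q' u ∧ (q' = p ∨ A.pos v n ω p ∉ P.boundary n) := by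
  by_cases hb : A.pos v n ω p ∈ P.boundary n
  · rcases h.le'.lt_or_eq with hlt | rfl
    · have h2 : q + 2 ≤ p := by have := hq hb; omega
      have hpq : q + (p - q) = p := by omega
      have heq : A.pos v n ω q = A.pos v n ω p := by
        by_contra hne
        refine hno q (p - q) ⟨by omega, h.last_mem, ?_, ?_, ?_⟩ hpq
        · rwa [hpq]
        · rwa [hpq]
        · rw [hpq]; exact h.after
      refine ⟨p, ⟨h.le.trans h.le', le_rfl, h.mem, h.first_mem, h.before, hb,
        fun r h1 h2 => by omega, fun ω' hω' => ?_⟩, Or.inl rfl⟩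
      rw [← h.eq_word ω' hω']
      refine InfPath.eq_of_trunc_of_tail (n := n) ?_ (tail_eq hP h.le' hp fun r h1 h2 => ?_)
      · exact (hag ω' hω' p le_rfl).trans (heq.symm.trans (hag ω' hω' q h.le').symm)
      · rw [hag ω' hω' r h2.le, hag ω' hω' (r + 1) h2]
        rcases h1.lt_or_eq with h1 | rfl
        · exact Or.inl (h.after r h1 h2)
        · exact Or.inr (h.after _ (by omega) (by omega))
    · exact ⟨q, h, Or.inl rfl⟩
  · exact ⟨q, h, Or.inr hb⟩

/-- Induction on time. Normalization is applied only before a further step, when no traverse can end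
at the current time; at the final time `p` a traverse may end. -/
theorem agreeUpTo_and_visitsBoundary (hP : P.IsTileInflation) (hU : A.IsGermSystem U m n)
    (hp : p ≤ v.length) (hno : ∀ k l, IsTraverse P n (A.pos v n ω) k l → p ≤ k + l) :
    AgreeUpTo A m n v ω p ∧ ((∀ r < p, A.pos v n ω r ∉ P.boundary n) ∨
      ∃ q₀ q u, VisitsBoundary A U m n v ω p q₀ q u ∧
        (A.pos v n ω p ∈ P.boundary n → q + 1 ≠ p)) := by
  induction p with
  | zero =>
    refine ⟨fun ω' hω' r hr => ?_, Or.inl fun r hr => by omega⟩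
    obtain rfl : r = 0 := by omega
    exact InfPath.trunc_eq_of_le (Nat.le_add_right n m) hω'
  | succ p ih =>
    obtain ⟨hag, h⟩ := ih (by omega) fun k l hkl => (Nat.le_succ p).trans (hno k l hkl)
    have key : ∀ q₀ q u, VisitsBoundary A U m n v ω p q₀ q u →
        (q = p ∨ A.pos v n ω p ∉ P.boundary n) → AgreeUpTo A m n v ω (p + 1) ∧
          ((∀ r < p + 1, A.pos v n ω r ∉ P.boundary n) ∨
            ∃ q₀ q u, VisitsBoundary A U m n v ω (p + 1) q₀ q u ∧
              (A.pos v n ω (p + 1) ∈ P.boundary n → q + 1 ≠ p + 1)) := by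
      intro q₀ q u h1 h2
      obtain ⟨h3, q', u', h4⟩ := h1.succ hP hU hp hag h2
      exact ⟨h3, Or.inr ⟨q₀, q', u', h4⟩⟩
    rcases h with h | ⟨q₀, q, u, h1, h2⟩
    · by_cases hb : A.pos v n ω p ∈ P.boundary n
      · exact key p p [] ⟨le_rfl, le_rfl, hU.nil_mem, hb, h, hb, fun r h1 h2 => by omega,
          fun _ _ => rfl⟩ (Or.inl rfl)
      · refine ⟨hag.succ fun ω' hω' => pos_succ_eq hP hp (Or.inl hb) (hag ω' hω' p le_rfl),
          Or.inl fun r hr => ?_⟩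
        rcases Nat.lt_succ_iff_lt_or_eq.1 hr with hr | rfl
        · exact h r hr
        · exact hb
    · obtain ⟨q', h3, h4⟩ := h1.normalize hP (by omega) hag h2 fun k l hkl => by
        have := hno k l hkl; omega
      exact key q₀ q' u h3 h4

/-- A piece of a trajectory before the end of the first traverse acts by a change of the first `n`
edges, a word from a finite set, and another change of the first `n` edges. -/
theorem exists_piece (hP : P.IsTileInflation) (hU : A.IsGermSystem U m n)
    (hp : p ≤ v.length) (hno : ∀ k l, IsTraverse P n (A.pos v n ω) k l → p ≤ k + l) :
    ∃ b c : B.FinPath n, ∃ u ∈ U, ∀ ω' : B.InfPath, ω'.trunc (n + m) = ω.trunc (n + m) →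
      (∀ r ≤ p, A.pos v n ω' r = A.pos v n ω r) ∧
      A.word (v.take p) ω' = InfPath.replace c (A.word u (InfPath.replace b ω')) := by
  obtain ⟨hag, h⟩ := agreeUpTo_and_visitsBoundary hP hU hp hno
  rcases h with h | ⟨q₀, q, u, h, hq⟩
  · refine ⟨A.pos v n ω 0, A.pos v n ω p, [], hU.nil_mem, fun ω' hω' => ⟨hag ω' hω', ?_⟩⟩
    rw [word_nil, InfPath.replace_eq (ζ := ω') (hag ω' hω' 0 (Nat.zero_le _)) fun _ _ => rfl]
    refine (InfPath.replace_eq (hag ω' hω' p le_rfl)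
      (tail_eq hP (Nat.zero_le p) hp fun r _ hr => Or.inl ?_)).symm
    rw [hag ω' hω' r hr.le]
    exact h r hr
  · refine ⟨A.pos v n ω q₀, A.pos v n ω p, u, h.mem, fun ω' hω' => ⟨hag ω' hω', ?_⟩⟩
    have h1 : InfPath.replace (A.pos v n ω q₀) ω' = A.word (v.take q₀) ω' := by
      refine InfPath.replace_eq (hag ω' hω' q₀ (h.le.trans h.le'))
        (tail_eq hP (Nat.zero_le q₀) ((h.le.trans h.le').trans hp) fun r _ hr => Or.inl ?_)
      rw [hag ω' hω' r (by have := h.le; have := h.le'; omega)]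
      exact h.before r hr
    rw [h1, ← h.eq_word ω' hω']
    refine (InfPath.replace_eq (hag ω' hω' p le_rfl)
      (tail_eq hP h.le' hp fun r h1 h2 => ?_)).symm
    rw [hag ω' hω' r h2.le, hag ω' hω' (r + 1) h2]
    rcases h1.lt_or_eq with h1 | rfl
    · exact Or.inl (h.after r h1 h2)
    -- The first step after the visit at `q` could change the tail only by leading straight to a
    -- boundary point; `hq` excludes this when the step ends at `p`.
    · rcases (Nat.succ_le_iff.2 h2).lt_or_eq with h3 | h3
      · exact Or.inr (h.after _ (by omega) h3)
      · refine Or.inr fun hb => ?_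
        rw [show q + 1 = p from h3] at hb
        exact hq hb h3

end PerfectAction

end BratteliDiagram.Connectors

/-! ### Coding group elements by finite tables. -/

namespace BratteliDiagram.Connectors

variable {V E S : Type*} {B : BratteliDiagram V E} {P : B.Connectors S}

theorem finite_traverses [Finite V] [Finite E] (P : B.Connectors S) (w : List S) (n : ℕ) (v : V) :
    (P.traverses w n v).Finite := by
  refine ((Set.finite_Iic w.length).prod ((Set.finite_Iic w.length).prod
    (Set.finite_univ (α := B.FinPath n)))).subset ?_
  rintro ⟨k, l, γ⟩ ⟨-, h, -⟩
  simp only at h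
  simp only [Set.mem_prod, Set.mem_Iic, Set.mem_univ, and_true]
  omega

namespace PerfectAction

variable [InvolutiveInv S] {A : PerfectAction P} {n m : ℕ} {v w : List S} {ω ω' : B.InfPath}

theorem pos_add (w : List S) (ω : B.InfPath) (k l : ℕ) :
    A.pos w n ω (k + l) = A.pos (w.drop k) n (A.word (w.take k) ω) l := by
  rw [pos, pos, ← word_append, List.take_add]

/-- Every step of a traverse has an end off the boundary, hence follows an arrow; the starting
vertex alone determines the positions. -/
theorem pos_eq_of_isTraverse (hP : P.IsTileInflation) {l : ℕ} (hl : l ≤ v.length)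
    (h : IsTraverse P n (A.pos v n ω) 0 l) (hω : A.pos v n ω' 0 = A.pos v n ω 0) {r : ℕ}
    (hr : r ≤ l) : A.pos v n ω' r = A.pos v n ω r := by
  obtain ⟨h2, -, -, -, hmid⟩ := h
  induction r with
  | zero => exact hω
  | succ r ih =>
    refine pos_succ_eq hP (by omega) ?_ (ih (by omega))
    rcases r.eq_zero_or_pos with rfl | hr0
    · exact Or.inr (hmid 1 (by omega) (by omega))
    · exact Or.inl (hmid r (by omega) (by omega))

/-- The times and places on level `n` at which the traverses by `w` end are not more numerous than
the traverses. -/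
theorem exists_markers [Fintype V] [Finite E] [Nonempty V] (A : PerfectAction P)
    (hP : P.IsTileInflation) (n T : ℕ) (w : List S) (hT : P.traverseCount w n ≤ T) :
    ∃ d : Fin T → ℕ × B.FinPath n, ∀ i k l : ℕ, ∀ ω : B.InfPath, i + (k + l) ≤ w.length →
      IsTraverse P n (A.pos (w.drop i) n ω) k l →
      ∃ a, d a = (i + (k + l), A.pos (w.drop i) n ω (k + l)) := by
  classical
  -- The end of a traverse depends only on its starting vertex, so it may be computed from any
  -- infinite extension.
  let ext : B.FinPath n → B.InfPath := Function.surjInv (InfPath.trunc_surjective n)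
  have hext : ∀ γ, (ext γ).trunc n = γ := Function.surjInv_eq _
  let f : ℕ × ℕ × B.FinPath n → ℕ × B.FinPath n := fun q =>
    (q.1 + q.2.1, A.pos (w.drop q.1) n (ext q.2.2) q.2.1)
  let Q : Set (ℕ × ℕ × B.FinPath n) := ⋃ v, P.traverses w n v
  have hQ : Q.Finite := Set.finite_iUnion fun v => finite_traverses P w n v
  have hQT : Q.ncard ≤ T := by
    refine le_trans ?_ hT
    rw [traverseCount, Set.ncard_eq_toFinset_card _ hQ]
    have : hQ.toFinset = Finset.univ.biUnion fun v => (finite_traverses P w n v).toFinset := by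
      ext q; simp [Q]
    rw [this]
    refine Finset.card_biUnion_le.trans_eq (Finset.sum_congr rfl fun v _ => ?_)
    rw [Set.ncard_eq_toFinset_card _ (finite_traverses P w n v)]
  have hM : (f '' Q).ncard ≤ T := (Set.ncard_image_le hQ).trans hQT
  have hMf : (f '' Q).Finite := hQ.image f
  have hd : ∃ d : Fin T → ℕ × B.FinPath n, f '' Q ⊆ Set.range d := by
    have hc : Nat.card (f '' Q) = (f '' Q).ncard := Nat.card_coe_set_eq _
    have : Finite (f '' Q) := hMf
    let e := (Finite.equivFin (f '' Q))
    obtain ⟨v⟩ := ‹Nonempty V›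
    obtain ⟨τ, -⟩ := InfPath.exists_src_eq (B := B) v
    -- Unused indices are padded with an arbitrary value, so that the number of states is `T` for
    -- all words.
    refine ⟨fun a => if h : (a : ℕ) < Nat.card (f '' Q) then (e.symm ⟨a, h⟩ : ℕ × B.FinPath n)
      else (0, τ.trunc n), fun y hy => ?_⟩
    refine ⟨⟨e ⟨y, hy⟩, (e ⟨y, hy⟩).2.trans_le (hc ▸ hM)⟩, ?_⟩
    simp only [Fin.is_lt, dif_pos, Fin.eta, Equiv.symm_apply_apply]
  obtain ⟨d, hd⟩ := hd
  refine ⟨d, fun i k l ω hle htr => hd ?_⟩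
  have hdrop : (w.drop i).drop k = w.drop (i + k) := by rw [List.drop_drop]
  have htr' : IsTraverse P n (A.pos (w.drop (i + k)) n (A.word ((w.drop i).take k) ω)) 0 l := by
    obtain ⟨h1, h2, h3, h4, h5⟩ := htr
    simp only [← hdrop, IsTraverse, ← pos_add, zero_add, add_zero]
    exact ⟨h1, h2, h3, h4, fun r h6 h7 => h5 _ (by omega) (by omega)⟩
  refine ⟨(i + k, l, A.pos (w.drop i) n ω k), ?_, ?_⟩
  · refine Set.mem_iUnion.2 ⟨_, htr.1, by simp only; omega,
      fun r => A.pos (w.drop i) n ω (k + r), rfl, rfl, fun r hr => ?_, htr.2.1, htr.2.2.1,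
      htr.2.2.2.1, fun r h1 h2 => htr.2.2.2.2 _ (by omega) (by simp only at h2; omega)⟩
    simp only at hr
    have hlt : i + k + r < w.length := by omega
    refine ⟨w[i + k + r], List.getElem?_eq_getElem hlt, ?_⟩
    have hs : (w.drop i)[k + r]? = some w[i + k + r] := by
      rw [List.getElem?_drop, ← add_assoc, List.getElem?_eq_getElem hlt]
    refine tileEdge_of_pos_notMem hP hs ?_
    have h1 := htr.1
    rcases r.eq_zero_or_pos with rfl | hr0
    · exact Or.inr (htr.2.2.2.2 _ (by omega) (by omega))
    · exact Or.inl (htr.2.2.2.2 _ (by omega) (by omega))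
  · refine Prod.ext (by simp only [f]; omega) ?_
    simp only [f]
    rw [pos_eq_of_isTraverse hP (by rw [List.length_drop]; omega) htr' ?_ le_rfl, pos_add, hdrop]
    exact hext _

/-- Transducers describing the action of words: the states are the vertices of the tiles of level
`n` and the ends of traverses. -/
abbrev Table (B : BratteliDiagram V E) (U : Set (List S)) (n m T : ℕ) : Type _ :=
  B.FinPath n ⊕ Fin T → (Fin m → E) →
    Option (B.FinPath n ⊕ Fin T) × B.FinPath n × U × B.FinPath n

/-- The output of an entry of a table. -/
noncomputable def output (A : PerfectAction P) {U : Set (List S)} {n : ℕ} {I : Type*}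
    (q : Option I × B.FinPath n × U × B.FinPath n) (ω : B.InfPath) : B.InfPath :=
  InfPath.replace q.2.2.2 (A.word q.2.2.1.1 (InfPath.replace q.2.1 ω))

/-- The entry `q` describes the action of the remaining part of the word `w` from the time `i` on
the path `ω`, where `d` is the list of times and positions that correspond to states. -/
def Describes (A : PerfectAction P) {U : Set (List S)} {n : ℕ} {I : Type*} (w : List S)
    (d : I → ℕ × B.FinPath n) (i : ℕ) (ω : B.InfPath)
    (q : Option I × B.FinPath n × U × B.FinPath n) : Prop :=
  (q.1 = none → A.word (w.drop i) ω = A.output q ω) ∧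
  ∀ a, q.1 = some a → i < (d a).1 ∧ (d a).1 ≤ w.length ∧ (A.output q ω).trunc n = (d a).2 ∧
    A.word (w.drop i) ω = A.word (w.drop (d a).1) (A.output q ω)

/-- The entry is the piece up to the first end of a traverse, with that end as the next state;
without a traverse it is the whole remaining word. -/
theorem exists_describes (hP : P.IsTileInflation) {U : Set (List S)} (hU : A.IsGermSystem U m n)
    {I : Type*} {d : I → ℕ × B.FinPath n}
    (hd : ∀ i k l : ℕ, ∀ ω : B.InfPath, i + (k + l) ≤ w.length →
      IsTraverse P n (A.pos (w.drop i) n ω) k l →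
      ∃ a, d a = (i + (k + l), A.pos (w.drop i) n ω (k + l))) {i : ℕ} (hi : i ≤ w.length)
    (ω : B.InfPath) :
    ∃ q : Option I × B.FinPath n × U × B.FinPath n, ∀ ω' : B.InfPath,
      ω'.trunc (n + m) = ω.trunc (n + m) → Describes A w d i ω' q := by
  classical
  have hlen : (w.drop i).length = w.length - i := List.length_drop
  by_cases h : ∃ p, p ≤ (w.drop i).length ∧
      ∃ k l, k + l = p ∧ IsTraverse P n (A.pos (w.drop i) n ω) k l
  · obtain ⟨hp, k, l, hkl, htr⟩ := Nat.find_spec h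
    have hmin := fun p => Nat.find_min' h (m := p)
    set p := Nat.find h
    obtain ⟨b, c, u, hu, hall⟩ := exists_piece hP hU (ω := ω) hp fun k' l' h' =>
      (le_or_gt (k' + l') (w.drop i).length).elim
        (fun hle => hmin (k' + l') ⟨hle, k', l', rfl, h'⟩) (fun hgt => hp.trans hgt.le)
    obtain ⟨a, ha⟩ := hd i k l ω (by omega) htr
    refine ⟨(some a, b, ⟨u, hu⟩, c), fun ω' hω' => ⟨fun h0 => by simp at h0, fun a' ha' => ?_⟩⟩
    obtain rfl : a = a' := by simpa using ha'
    have hout : A.output ((some a, b, ⟨u, hu⟩, c) : Option I × B.FinPath n × U × B.FinPath n) ω' =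
      A.word ((w.drop i).take p) ω' := ((hall ω' hω').2).symm
    rw [hout, ha, hkl]
    have h2 := htr.1
    refine ⟨by simp only; omega, by simp only; omega, (hall ω' hω').1 p le_rfl, ?_⟩
    rw [← word_append, ← List.drop_drop, List.take_append_drop]
  · push Not at h
    obtain ⟨b, c, u, hu, hall⟩ := exists_piece hP hU (ω := ω) le_rfl fun k' l' h' =>
      (le_or_gt (k' + l') (w.drop i).length).elim
        (fun hle => (h (k' + l') hle k' l' rfl h').elim) (fun hgt => hgt.le)
    refine ⟨(none, b, ⟨u, hu⟩, c), fun ω' hω' => ⟨fun _ => ?_, fun a' ha' => by simp at ha'⟩⟩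
    have := (hall ω' hω').2
    rw [List.take_length] at this
    exact this

/-- Run a table for at most `f` steps. -/
noncomputable def run (A : PerfectAction P) {U : Set (List S)} {n m T : ℕ} (t : Table B U n m T) :
    ℕ → B.FinPath n ⊕ Fin T → B.InfPath → B.InfPath
  -- The value when the steps run out is irrelevant: each transition strictly increases the time, so
  -- `|w| + 1` steps suffice.
  | 0, _, ω => ω
  | f + 1, a, ω =>
    match (t a fun k => ω.1 (n + k)).1 with
    | none => A.output (t a fun k => ω.1 (n + k)) ω
    | some a' => run A t f a' (A.output (t a fun k => ω.1 (n + k)) ω)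

theorem run_eq {U : Set (List S)} {T : ℕ} {t : Table B U n m T}
    {d : B.FinPath n ⊕ Fin T → ℕ × B.FinPath n}
    (ht : ∀ a (ω : B.InfPath), (d a).1 ≤ w.length → ω.trunc n = (d a).2 →
      Describes A w d (d a).1 ω (t a fun k => ω.1 (n + k))) (f : ℕ) :
    ∀ a (ω : B.InfPath), (d a).1 ≤ w.length → ω.trunc n = (d a).2 → w.length < (d a).1 + f →
      A.run t f a ω = A.word (w.drop (d a).1) ω := by
  induction f with
  | zero => intro a ω h1 _ h3; omega
  | succ f ih =>
    intro a ω h1 h2 h3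
    obtain ⟨hn, hs⟩ := ht a ω h1 h2
    rw [run]
    split
    · next heq => exact (hn heq).symm
    · next a' heq =>
      obtain ⟨h4, h5, h6, h7⟩ := hs a' heq
      rw [h7]
      exact ih a' _ h5 h6 (by omega)

/-- The word and the times of the states serve only to build the table; running it refers to
neither, which is what makes counting tables enough. -/
theorem exists_table [Fintype V] [Finite E] [Nonempty V] (A : PerfectAction P)
    (hP : P.IsTileInflation) {U : Set (List S)} (hU : A.IsGermSystem U m n) (hm : 0 < m) {T : ℕ}
    {w : List S} (hT : P.traverseCount w n ≤ T) {f : ℕ} (hf : w.length < f) :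
    ∃ t : Table B U n m T, ∀ ω, A.run t f (Sum.inl (ω.trunc n)) ω = A.word w ω := by
  obtain ⟨d₀, hd₀⟩ := exists_markers A hP n T w hT
  let d : B.FinPath n ⊕ Fin T → ℕ × B.FinPath n := Sum.elim (fun γ => (0, γ)) d₀
  have hd : ∀ i k l : ℕ, ∀ ω : B.InfPath, i + (k + l) ≤ w.length →
      IsTraverse P n (A.pos (w.drop i) n ω) k l →
      ∃ a, d a = (i + (k + l), A.pos (w.drop i) n ω (k + l)) := fun i k l ω h1 h2 => by
    obtain ⟨a, ha⟩ := hd₀ i k l ω h1 h2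
    exact ⟨Sum.inr a, ha⟩
  have hentry : ∀ a (e : Fin m → E), ∃ q : Option (B.FinPath n ⊕ Fin T) × B.FinPath n × U ×
      B.FinPath n, ∀ ω : B.InfPath, (d a).1 ≤ w.length → ω.trunc n = (d a).2 →
        (∀ k : Fin m, ω.1 (n + k) = e k) → Describes A w d (d a).1 ω q := by
    intro a e
    by_cases h : ∃ ω : B.InfPath, (d a).1 ≤ w.length ∧ ω.trunc n = (d a).2 ∧
        ∀ k : Fin m, ω.1 (n + k) = e k
    · obtain ⟨ω, h1, h2, h3⟩ := h
      obtain ⟨q, hq⟩ := exists_describes hP hU hd h1 ω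
      refine ⟨q, fun ω' _ h2' h3' => hq ω' ?_⟩
      have hedge : ∀ i < n + m, ω'.1 i = ω.1 i := fun i hi => by
        rcases lt_or_ge i n with hin | hin
        · exact (InfPath.trunc_eq_iff.1 (h2'.trans h2.symm)).1 i hin
        · obtain ⟨k, rfl⟩ := Nat.exists_eq_add_of_le hin
          exact (h3' ⟨k, by omega⟩).trans (h3 ⟨k, by omega⟩).symm
      refine InfPath.trunc_eq_iff.2 ⟨hedge, ?_⟩
      -- A truncation also records its end vertex; as `m > 0`, this is the range of the last edge
      -- read.
      rw [show n + m = n + m - 1 + 1 by omega, ← ω'.2, ← ω.2, hedge _ (by omega)]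
    · exact ⟨(none, (d a).2, ⟨[], hU.nil_mem⟩, (d a).2), fun ω h1 h2 h3 => (h ⟨ω, h1, h2, h3⟩).elim⟩
  choose t ht using hentry
  refine ⟨t, fun ω => ?_⟩
  exact run_eq (d := d) (fun a ω h1 h2 => ht a _ ω h1 h2 fun _ => rfl) f (Sum.inl (ω.trunc n)) ω
    (Nat.zero_le _) rfl (by simpa [d] using hf)

/-- The number of group elements of length at most `R`, bounded by the number of tables. -/
theorem growth_le [Fintype V] [Finite E] [Nonempty V] (A : PerfectAction P)
    (hP : P.IsTileInflation) {U : Set (List S)} (hUf : U.Finite) (hU : A.IsGermSystem U m n)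
    (hm : 0 < m) {T : ℕ} {R : ℝ}
    (hT : ∀ w : List S, (w.length : ℝ) ≤ R → P.traverseCount w n ≤ T) :
    A.growth R ≤ (((Nat.card (B.FinPath n) + T + 1) * (Nat.card (B.FinPath n) *
      (U.ncard * Nat.card (B.FinPath n)))) ^
        ((Nat.card (B.FinPath n) + T) * Nat.card E ^ m) : ℕ) := by
  have : Finite U := hUf
  -- One bound on the number of steps for all words of length at most `R`, so the table alone
  -- determines the element.
  let f := ⌊R⌋₊ + 1
  have h : ∀ g : {g : A.group | ∃ w : List S, (w.length : ℝ) ≤ R ∧ A.word w = g},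
      ∃ t : Table B U n m T, ∀ ω, A.run t f (Sum.inl (ω.trunc n)) ω = g.1.1 ω := by
    rintro ⟨g, w, hw, hg⟩
    obtain ⟨t, ht⟩ := exists_table A hP hU hm (hT w hw) (f := f)
      (Nat.lt_succ_of_le (Nat.le_floor hw))
    exact ⟨t, fun ω => (ht ω).trans (congrArg (fun h : B.InfPath ≃ₜ B.InfPath => h ω) hg)⟩
  choose t ht using h
  have hinj : Function.Injective t := fun g g' hgg => by
    refine Subtype.ext (Subtype.ext (Homeomorph.ext fun ω => ?_))
    rw [← ht g ω, ← ht g' ω, hgg]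
  have hcard := Nat.card_le_card_of_injective t hinj
  rw [growth, Nat.cast_le, ← Nat.card_coe_set_eq]
  refine hcard.trans_eq ?_
  have hU' : Nat.card U = U.ncard := Nat.card_coe_set_eq U
  rw [Table, Nat.card_fun, Nat.card_fun, Nat.card_prod, Nat.card_prod, Nat.card_prod,
    Finite.card_option, Nat.card_sum, Nat.card_fun, Nat.card_fin, Nat.card_fin, hU', ← pow_mul]
  congr 1
  ring

end PerfectAction

end BratteliDiagram.Connectors

/-! ### The number of paths and the numerical estimate. -/

namespace BratteliDiagram

variable {V E S : Type*} {B : BratteliDiagram V E}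

theorem card_finPath_le [Finite V] [Finite E] (n : ℕ) :
    Nat.card (B.FinPath n) ≤ Nat.card V * Nat.card E ^ n := by
  have h : Function.Injective fun p : B.FinPath n => (p.last, p.edge) := by
    intro p q h
    simp only [Prod.mk.injEq] at h
    refine FinPath.ext (funext fun i => ?_) h.2
    refine Fin.lastCases h.1 (fun i => ?_) i
    rw [← p.src_edge, ← q.src_edge, h.2]
  simpa [Nat.card_prod, Nat.card_fun] using Nat.card_le_card_of_injective _ h

theorem card_finPath_pos [Finite V] [Finite E] [Nonempty V] (n : ℕ) :
    0 < Nat.card (B.FinPath n) := by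
  obtain ⟨v⟩ := ‹Nonempty V›
  obtain ⟨τ, -⟩ := InfPath.exists_src_eq (B := B) v
  have : Nonempty (B.FinPath n) := ⟨τ.trunc n⟩
  exact Nat.card_pos

namespace Connectors

theorem sum_card_tile [Fintype V] [Finite E] (n : ℕ) :
    ∑ v : V, Nat.card (Tile B n v) = Nat.card (B.FinPath n) := by
  rw [← Nat.card_sigma, Nat.card_congr (Equiv.sigmaFiberEquiv FinPath.last)]

/-- Boundedness is needed to compare the real-valued `limsup` with the terms. -/
theorem isBoundedUnder_card [Finite V] [Finite E] [Nonempty V] :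
    Filter.IsBoundedUnder (· ≤ ·) Filter.atTop
      fun n : ℕ => (Nat.card (B.FinPath n) : ℝ) ^ (1 / (n : ℝ)) := by
  refine Filter.isBoundedUnder_of_eventually_le (a := (Nat.card V * Nat.card E : ℝ)) ?_
  filter_upwards [Filter.eventually_ge_atTop 1] with n hn
  have hV : 1 ≤ Nat.card V := Nat.card_pos
  have h1 : Nat.card (B.FinPath n) ≤ (Nat.card V * Nat.card E) ^ n := by
    refine (card_finPath_le n).trans ?_
    rw [mul_pow]
    exact Nat.mul_le_mul_right _ (Nat.le_self_pow (by omega) _)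
  calc (Nat.card (B.FinPath n) : ℝ) ^ (1 / (n : ℝ))
      ≤ (((Nat.card V * Nat.card E : ℝ)) ^ n) ^ (1 / (n : ℝ)) :=
        Real.rpow_le_rpow (by positivity) (by exact_mod_cast h1) (by positivity)
    _ = (Nat.card V * Nat.card E : ℝ) := by
        rw [one_div, Real.pow_rpow_inv_natCast (by positivity) (by omega)]

theorem one_le_tileGrowthRate [Fintype V] [Finite E] [Nonempty V] : 1 ≤ tileGrowthRate B := by
  simp only [tileGrowthRate, sum_card_tile]
  refine Filter.le_limsup_of_frequently_le (Filter.Frequently.of_forall fun n => ?_)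
    isBoundedUnder_card
  refine Real.one_le_rpow ?_ (by positivity)
  exact_mod_cast card_finPath_pos n

theorem eventually_card_le [Fintype V] [Finite E] [Nonempty V] {l : ℝ}
    (hl : Real.log (tileGrowthRate B) < l) :
    ∀ᶠ n : ℕ in Filter.atTop, (Nat.card (B.FinPath n) : ℝ) ≤ Real.exp (l * n) := by
  have h : tileGrowthRate B < Real.exp l :=
    (Real.log_lt_iff_lt_exp (zero_lt_one.trans_le one_le_tileGrowthRate)).1 hl
  simp only [tileGrowthRate, sum_card_tile] at h
  filter_upwards [Filter.eventually_lt_of_limsup_lt h isBoundedUnder_card,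
    Filter.eventually_ge_atTop 1] with n hn hn1
  rw [mul_comm, Real.exp_nat_mul]
  calc (Nat.card (B.FinPath n) : ℝ)
      = ((Nat.card (B.FinPath n) : ℝ) ^ (1 / (n : ℝ))) ^ n := by
        rw [one_div, Real.rpow_inv_natCast_pow (by positivity) (by omega)]
    _ ≤ Real.exp l ^ n := pow_le_pow_left₀ (by positivity) hn.le n

end Connectors

end BratteliDiagram

/-- With `Y = C₁ * R ^ δ`, the logarithm of the left side is at most a constant times `Y (1 + log
Y)`, and the gap between `δ` and `α` pays for the logarithm. -/
theorem exists_pow_le_exp_rpow {δ α C₁ : ℝ} (hδ : 0 < δ) (hδα : δ < α) (hC₁ : 1 ≤ C₁) (u k : ℕ) :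
    ∃ C : ℝ, 1 ≤ C ∧ ∀ R : ℝ, 1 ≤ R → ∀ a T : ℕ, (a + T + 1 : ℝ) ≤ C₁ * R ^ δ →
      ((((a + T + 1) * (a * (u * a))) ^ ((a + T) * k) : ℕ) : ℝ) ≤ Real.exp ((C * R) ^ α) := by
  have hα : 0 < α := hδ.trans hδα
  -- Chosen so that `Y * Y ^ η = Y ^ (α / δ)` is a constant times `R ^ α`.
  set η := α / δ - 1 with hη
  have hη0 : 0 < η := by rw [hη, sub_pos, one_lt_div hδ]; exact hδα
  set C₂ : ℝ := k * (u + 3 / η) * C₁ ^ (1 + η) with hC₂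
  have hC₂0 : 0 ≤ C₂ := by positivity
  refine ⟨max 1 (C₂ ^ (1 / α)), le_max_left _ _, fun R hR a T h => ?_⟩
  have hR0 : 0 < R := by linarith
  have hfinal : C₂ * R ^ α ≤ (max 1 (C₂ ^ (1 / α)) * R) ^ α := by
    rw [Real.mul_rpow (by positivity) hR0.le]
    gcongr
    calc C₂ = (C₂ ^ (1 / α)) ^ α := by
          rw [← Real.rpow_mul hC₂0, one_div_mul_cancel hα.ne', Real.rpow_one]
      _ ≤ _ := Real.rpow_le_rpow (by positivity) (le_max_right _ _) hα.le
  refine le_trans ?_ (Real.exp_le_exp.2 hfinal)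
  set Y := C₁ * R ^ δ with hY
  have hY1 : 1 ≤ Y := one_le_mul_of_one_le_of_one_le hC₁ (Real.one_le_rpow hR hδ.le)
  have hY0 : 0 < Y := by linarith
  have ha0 : (0 : ℝ) ≤ a := by positivity
  have hT0 : (0 : ℝ) ≤ T := by positivity
  have hbase : (((a + T + 1) * (a * (u * a)) : ℕ) : ℝ) ≤ Real.exp (u + 3 * Real.log Y) := by
    have hu : (u : ℝ) ≤ Real.exp u := by linarith [Real.add_one_le_exp (u : ℝ)]
    have h3 : Real.exp (3 * Real.log Y) = Y ^ 3 := by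
      rw [mul_comm, Real.exp_mul, Real.exp_log hY0]
      norm_cast
    rw [Real.exp_add, h3]
    push_cast
    calc ((a : ℝ) + T + 1) * (a * (u * a)) = u * ((a + T + 1) * (a * a)) := by ring
      _ ≤ Real.exp u * (Y * (Y * Y)) := by gcongr <;> linarith
      _ = Real.exp u * Y ^ 3 := by ring
  have hlog : Real.log Y ≤ Y ^ η / η := Real.log_le_rpow_div hY0.le hη0
  have hlog0 : 0 ≤ Real.log Y := Real.log_nonneg hY1
  have hYη : 1 ≤ Y ^ η := Real.one_le_rpow hY1 hη0.le
  have hexp : ((a + T) * k : ℕ) * (u + 3 * Real.log Y) ≤ C₂ * R ^ α := by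
    have hYR : Y ^ (1 + η) = C₁ ^ (1 + η) * R ^ α := by
      rw [hY, Real.mul_rpow (by linarith) (by positivity), ← Real.rpow_mul hR0.le]
      congr 2
      rw [hη]
      field_simp
      ring
    calc (((a + T) * k : ℕ) : ℝ) * (u + 3 * Real.log Y)
        ≤ Y * k * (u * Y ^ η + 3 * (Y ^ η / η)) := by
          push_cast
          gcongr
          · linarith
          · nlinarith [(Nat.cast_nonneg u : (0 : ℝ) ≤ u)]
      _ = k * (u + 3 / η) * (Y * Y ^ η) := by ring
      _ = k * (u + 3 / η) * Y ^ (1 + η) := by rw [Real.rpow_add hY0, Real.rpow_one]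
      _ = C₂ * R ^ α := by rw [hYR, hC₂]; ring
  refine le_trans ?_ (Real.exp_le_exp.2 hexp)
  rw [Real.exp_nat_mul, Nat.cast_pow]
  exact pow_le_pow_left₀ (by positivity) hbase _

/-! ### Conclusion: the choice of the level. -/

namespace BratteliDiagram.Connectors

theorem PerfectAction.growth_le_one_of_isEmpty {V E S : Type*} [InvolutiveInv S] [IsEmpty V]
    {B : BratteliDiagram V E} {P : B.Connectors S} (A : PerfectAction P) (R : ℝ) :
    A.growth R ≤ 1 := by
  have hB : IsEmpty B.InfPath := ⟨fun ω => isEmptyElim (B.src (ω.1 0))⟩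
  rw [PerfectAction.growth, Nat.cast_le_one]
  have hsub : Subsingleton A.group :=
    ⟨fun g g' => Subtype.ext (Homeomorph.ext fun ω => isEmptyElim ω)⟩
  exact Set.ncard_le_one_iff_subsingleton.2 Set.subsingleton_of_subsingleton

/-- A bound on the generating function of the traverses gives a bound on their number. -/
theorem traverseCount_le {V E S : Type*} [Fintype V] {B : BratteliDiagram V E}
    {P : B.Connectors S} {t C : ℝ} (ht : 0 < t) {w : List S}
    (hs : Summable fun n : ℕ => (P.traverseCount w n : ℝ) * t ^ n)
    (h : ∑' n : ℕ, (P.traverseCount w n : ℝ) * t ^ n ≤ C) (n : ℕ) :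
    (P.traverseCount w n : ℝ) ≤ C / t ^ n := by
  rw [le_div_iff₀ (pow_pos ht n)]
  exact (hs.le_tsum n fun _ _ => by positivity).trans h

end BratteliDiagram.Connectors

theorem mainTheorem2 {V E S : Type*} [Fintype V] [Finite E] [Finite S] [InvolutiveInv S]
    (B : BratteliDiagram V E) (hB : B.IsSimple)
    (P : B.Connectors S) (hP : P.IsTileInflation) (hbd : P.IsBoundedType) (hst : P.IsStationary)
    (A : BratteliDiagram.Connectors.PerfectAction P) (hmin : A.IsMinimal)
    (hcontr : A.IsContracting)
    (t₀ : ℝ) (ht₀ : 1 < t₀) (Ψ : ℝ → ℝ)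
    (hΨ : ∀ (w : List S) (t : ℝ), 0 ≤ t → t < t₀ →
      Summable (fun n : ℕ => (P.traverseCount w n : ℝ) * t ^ n) ∧
      ∑' n : ℕ, (P.traverseCount w n : ℝ) * t ^ n ≤ w.length * Ψ t)
    (α : ℝ)
    (hα : Real.log (BratteliDiagram.Connectors.tileGrowthRate B) /
      (Real.log (BratteliDiagram.Connectors.tileGrowthRate B) + Real.log t₀) < α) :
    GrowthDominated A.growth (fun R => Real.exp (R ^ α)) := by
  rcases isEmpty_or_nonempty V with hV | hV
  · exact ⟨1, le_rfl, fun R hR => (A.growth_le_one_of_isEmpty R).trans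
      (Real.one_le_exp (Real.rpow_nonneg (by linarith) _))⟩
  set b := Real.log (Connectors.tileGrowthRate B) with hb
  set c := Real.log t₀ with hc
  have hb0 : 0 ≤ b := Real.log_nonneg Connectors.one_le_tileGrowthRate
  have hc0 : 0 < c := Real.log_pos ht₀
  have hD : 0 < b + c := by linarith
  have hα' : b < α * (b + c) := (div_lt_iff₀ hD).1 hα
  -- A single `ε` pays for both losses: `β` is only a limit superior, and `t` has to stay below
  -- `t₀`.
  obtain ⟨ε, hε0, hεc, hεα⟩ : ∃ ε : ℝ, 0 < ε ∧ ε < c ∧ b + ε < α * (b + c) := by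
    refine ⟨min (c / 2) ((α * (b + c) - b) / 2), lt_min (by linarith) (by linarith), ?_, ?_⟩
    · linarith [min_le_left (c / 2) ((α * (b + c) - b) / 2)]
    · linarith [min_le_right (c / 2) ((α * (b + c) - b) / 2)]
  set δ := (b + ε) / (b + c) with hδ
  have hδ0 : 0 < δ := by positivity
  have hδα : δ < α := (div_lt_iff₀ hD).2 hεα
  obtain ⟨N₁, hN₁⟩ := Filter.eventually_atTop.1
    (Connectors.eventually_card_le (B := B) (l := b + ε) (by linarith))
  obtain ⟨U, m, N₂, hUf, hm, hU⟩ :=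
    A.exists_isGermSystem hP hbd.infBoundary_finite hst hcontr
  set N := max N₁ N₂ with hN
  set t := Real.exp (c - ε) with ht
  have htt₀ : t < t₀ := by
    rw [ht, ← Real.lt_log_iff_exp_lt (by linarith)]
    linarith
  set C₁ := Real.exp ((b + ε) * (N + 1)) + |Ψ t| + 1 with hC₁
  have hC₁1 : 1 ≤ C₁ := by
    have := Real.exp_pos ((b + ε) * (N + 1))
    have := abs_nonneg (Ψ t)
    linarith
  obtain ⟨C, hC, hbound⟩ :=
    exists_pow_le_exp_rpow hδ0 hδα hC₁1 U.ncard (Nat.card E ^ m)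
  refine ⟨C, hC, fun R hR => ?_⟩
  have hR0 : 0 < R := by linarith
  -- The balancing depth: `exp (b * x)` equals `R / exp (c * x)`. The actual level is `x` rounded up
  -- and shifted by `N`, which costs only a constant factor.
  set x := Real.log R / (b + c) with hx
  have hx0 : 0 ≤ x := div_nonneg (Real.log_nonneg hR) hD.le
  have hRx : R = Real.exp ((b + c) * x) := by
    rw [hx, mul_div_cancel₀ _ hD.ne', Real.exp_log hR0]
  have hRδ : R ^ δ = Real.exp ((b + ε) * x) := by
    rw [hRx, ← Real.exp_mul, hδ]
    congr 1
    field_simp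
  have hRδ1 : 1 ≤ R ^ δ := Real.one_le_rpow hR hδ0.le
  set n := ⌈x⌉₊ + N with hn
  have hxn : x ≤ n := by
    rw [hn]; push_cast
    linarith [Nat.le_ceil x, (Nat.cast_nonneg N : (0 : ℝ) ≤ N)]
  have hnx : (n : ℝ) ≤ x + (N + 1) := by
    rw [hn]; push_cast
    linarith [Nat.ceil_lt_add_one hx0]
  have hcard : (Nat.card (B.FinPath n) : ℝ) ≤ Real.exp ((b + ε) * (N + 1)) * R ^ δ := by
    refine (hN₁ n (by omega)).trans ?_
    rw [hRδ, ← Real.exp_add, ← mul_add, add_comm _ x]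
    gcongr
  have htrav : ∀ w : List S, (w.length : ℝ) ≤ R →
      (P.traverseCount w n : ℝ) ≤ |Ψ t| * R ^ δ := by
    intro w hw
    obtain ⟨h1, h2⟩ := hΨ w t (Real.exp_pos _).le htt₀
    have h3 : (w.length : ℝ) * Ψ t ≤ R * |Ψ t| :=
      (mul_le_mul_of_nonneg_left (le_abs_self _) (Nat.cast_nonneg _)).trans
        (mul_le_mul_of_nonneg_right hw (abs_nonneg _))
    refine (Connectors.traverseCount_le (Real.exp_pos _) h1 (h2.trans h3) n).trans ?_
    rw [mul_comm R, mul_div_assoc]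
    refine mul_le_mul_of_nonneg_left ?_ (abs_nonneg _)
    rw [hRδ, ← Real.exp_nat_mul, hRx, ← Real.exp_sub, Real.exp_le_exp]
    -- As `x ≤ n` and `ε < c`, the exponent `(b + c) x - (c - ε) n` is at most `(b + ε) x`.
    nlinarith
  set T := ⌊|Ψ t| * R ^ δ⌋₊ with hT
  refine (A.growth_le hP hUf (hU n (by omega)) hm (T := T) fun w hw =>
    Nat.le_floor (htrav w hw)).trans (hbound R hR _ T ?_)
  have hTle : (T : ℝ) ≤ |Ψ t| * R ^ δ := Nat.floor_le (by positivity)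
  calc (Nat.card (B.FinPath n) : ℝ) + T + 1
      ≤ Real.exp ((b + ε) * (N + 1)) * R ^ δ + |Ψ t| * R ^ δ + 1 * R ^ δ := by linarith
    _ = C₁ * R ^ δ := by rw [hC₁]; ring
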